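/- Let $\Gamma(1)=\mathrm{PSL}_2(\mathbb Z)$ act on the upper half plane $\mathbb H$ by Möbius transformations, and equip $\mathbb H$ with the hyperbolic measure $dx\,dy/y^2$. Let $\Gamma\subset\Gamma(1)$ be a torsion-free normal subgroup of finite index and $\Gamma_{\rm par}\subset\Gamma$ the subgroup generated by all parabolic elements of $\Gamma$. Let $I_\Gamma\subset\mathbb C[\Gamma]$ be the augmentation ideal, and for $q\ge 0$ put $J_{q+1}=I_\Gamma^{q+1}+\mathbb C[\Gamma]\,I_{\Gamma_{\rm par}}$. Let $\Gamma(1)$ act on functions on $\mathbb H$ by $(\gamma f)(z)=f(\gamma^{-1}z)$, and let $F_q$ be the space of all measurable functions $f:\mathbb H\to\mathbb C$ with $J_{q+1}f=0$, all modulo null functions. Let $\mathbb H_\Gamma\supset\mathbb H$ be the Borel–Serre space, in which to every cusp $c$ of $\Gamma$ the real line $\mathbb P^1(\mathbb R)\smallsetminus\{c\}$ is attached. If $c=g\infty$ with $g\in \mathrm{SL}_2(\mathbb R)$, the point $gx$ ($x\in\mathbb R$) of this line has as basic neighbourhoods the sets consisting of $g\{z:|\mathrm{Re}\,z-x|<\varepsilon,\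 \mathrm{Im}\,z>1/\varepsilon\}$ and all $gx'$ with $|x'-x|<\varepsilon$. The boundary $\mathbb H_\Gamma\smallsetminus\mathbb H$ is given measure zero. Let $L^2_q(\Gamma\backslash\mathbb H)$ be the space of all $f\in F_q$ that lie in $L^2_{\rm loc}(\mathbb H_\Gamma)$, i.e. are square integrable on some neighbourhood of every point of $\mathbb H_\Gamma$. Let $S$ be a finite symmetric set of generators of $\Gamma$ with $1\in S$, and let $D\subset\mathbb H$ be a closed fundamental domain of $\Gamma$ with finitely many geodesic sides: $D$ is closed, its translates $\gamma D$ $(\gamma\in\Gamma)$ cover $\mathbb H$, have pairwise disjoint interiors and form a locally finite family in $\mathbb H$, and the boundary of $D$ is a finite union of geodesic arcs. Put $S^qD=\bigcup_{s_1,\dots,s_q\in S}s_1\cdots s_qD$. Then for every $q\ge0$ the following hold. 1. Every $f\in F_q$ is uniquely determined by its restriction to $S^qD$. 2. $F_q\cap L^2(S^qD)=L^2_q(\Gamma\backslash\mathbb H)$; that is, an element of $F_q$ is square integrable on $S^qD$ if and only if it lies in $L^2_q(\Gamma\backslash\mathbb H)$. 3. Restriction to $S^qD$ identifies $L^2_q(\Gamma\backslash\mathbb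 H)$ with a closed subspace of the Hilbert space $L^2(S^qD)$. 4. The induced Hilbert space topology on $L^2_q(\Gamma\backslash\mathbb H)$ does not depend on the choice of $S$ and $D$. For $q\ge1$ the inner product does: for every choice $(S,D)$ there is another choice that induces a different inner product. 5. The group $\Gamma(1)$ preserves $L^2_q(\Gamma\backslash\mathbb H)$ and acts on it continuously. With respect to the inner product induced by $(S,D)$ this action is unitary if and only if $q=0$ or there is no nonzero group homomorphism $\Gamma/\Gamma_{\rm par}\to(\mathbb C,+)$. In particular, if such a homomorphism exists, the action is unitary for $q=0$ and not unitary for every $q\ge1$. -/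

import Mathlib

open scoped MatrixGroups Pointwise Topology
open MeasureTheory UpperHalfPlane

noncomputable section

/-! ### Higher order invariants -/

section HigherInvariants

variable {G : Type*} [Group G]

/-- The augmentation ideal `I_G` of `ℂ[G]`: the kernel of `∑ c_g g ↦ ∑ c_g`. -/
def augIdeal (G : Type*) [Group G] : Ideal (MonoidAlgebra ℂ G) :=
  RingHom.ker (MonoidAlgebra.lift ℂ ℂ G (1 : G →* ℂ))

/-- The left ideal `ℂ[G] I_P` of `ℂ[G]` generated by the augmentation ideal of a subgroup `P`. -/
def relAugIdeal (P : Subgroup G) : Ideal (MonoidAlgebra ℂ G) :=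
  Ideal.span (MonoidAlgebra.mapDomainRingHom ℂ P.subtype '' (augIdeal P : Set (MonoidAlgebra ℂ P)))

/-- The ideal `J_q = I_G ^ q + ℂ[G] I_P`. -/
def orderIdeal (P : Subgroup G) (q : ℕ) : Ideal (MonoidAlgebra ℂ G) :=
  augIdeal G ^ q ⊔ relAugIdeal P

/-- The invariants of type `P` and order `q` of a `ℂ[G]`-module `W`: all `w` with
`J_{q+1} w = 0`. -/
def higherInvariants {W : Type*} [AddCommGroup W] [Module ℂ W] (ρ : Representation ℂ G W)
    (P : Subgroup G) (q : ℕ) : Submodule ℂ W :=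
  ⨅ x ∈ orderIdeal P (q + 1), LinearMap.ker (ρ.asAlgebraHom x)

end HigherInvariants

/-! ### The modular group `Γ(1) = PSL(2, ℤ)` acting on the upper half plane -/

theorem center_SL2Z_smul (g : SL(2, ℤ)) (hg : g ∈ Subgroup.center SL(2, ℤ)) (z : ℍ) :
    g • z = z := by
  obtain ⟨r, hr, hg⟩ := Matrix.SpecialLinearGroup.mem_center_iff.mp hg
  have hr2 : r * r = 1 := by simpa [sq] using hr
  rcases mul_self_eq_one_iff.mp hr2 with h | h
  · have : g = 1 := by
      ext i j
      rw [← hg, h]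
      simp
    simp [this]
  · have : g = -1 := by
      ext i j
      rw [← hg, h]
      simp
    rw [this, ModularGroup.SL_neg_smul, one_smul]

/-- The action of `PSL(2, ℤ)` on the upper half plane by Möbius transformations. -/
instance : MulAction PSL(2, ℤ) ℍ :=
  MulAction.compHom ℍ (QuotientGroup.lift (Subgroup.center SL(2, ℤ))
    (MulAction.toPermHom SL(2, ℤ) ℍ)
    (fun g hg => Equiv.ext fun z => center_SL2Z_smul g hg z))

theorem PSL2Z_mk_smul (g : SL(2, ℤ)) (z : ℍ) : ((g : PSL(2, ℤ)) • z : ℍ) = g • z := rfl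

instance : ContinuousConstSMul PSL(2, ℤ) ℍ where
  continuous_const_smul γ := by
    induction γ using QuotientGroup.induction_on with
    | H g => exact continuous_const_smul (Matrix.SpecialLinearGroup.mapGL ℝ g)

instance : SMulInvariantMeasure PSL(2, ℤ) ℍ volume where
  measure_preimage_smul γ s hs := by
    induction γ using QuotientGroup.induction_on with
    | H g => exact measure_preimage_smul_of_nullMeasurableSet hs.nullMeasurableSet
                (Matrix.SpecialLinearGroup.mapGL ℝ g)

/-- The action of `PSL(2, ℤ)` on measurable functions on `ℍ` modulo null functions (with respect
to the hyperbolic measure): `(γ f)(z) = f (γ⁻¹ z)`. -/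
def translation : Representation ℂ PSL(2, ℤ) (ℍ →ₘ[volume] ℂ) where
  toFun γ :=
    { toFun := fun f => DomMulAct.mk γ⁻¹ • f
      map_add' := fun f g => smul_add _ f g
      map_smul' := fun c f => smul_comm _ c f }
  map_one' := by
    ext1 f
    change DomMulAct.mk (1 : PSL(2, ℤ))⁻¹ • f = f
    rw [inv_one, DomMulAct.mk_one, one_smul]
  map_mul' γ δ := by
    ext1 f
    change DomMulAct.mk (γ * δ)⁻¹ • f = DomMulAct.mk γ⁻¹ • DomMulAct.mk δ⁻¹ • f
    rw [mul_inv_rev, DomMulAct.mk_mul, mul_smul]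

theorem translation_ae (γ : PSL(2, ℤ)) (f : ℍ →ₘ[volume] ℂ) :
    translation γ f =ᵐ[volume] fun z => f (γ⁻¹ • z) :=
  DomMulAct.smul_aeeqFun_aeeq (DomMulAct.mk γ⁻¹) f

variable (Γ : Subgroup PSL(2, ℤ))

/-- The subgroup of `Γ` generated by its parabolic elements. -/
def parSubgroup : Subgroup Γ :=
  Subgroup.closure {γ : Γ | ∃ g : SL(2, ℤ), (g : PSL(2, ℤ)) = γ ∧
    (Matrix.SpecialLinearGroup.mapGL ℝ g).IsParabolic}

/-- The space `F_q` of measurable functions `f : ℍ → ℂ` with `J_{q+1} f = 0`,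
modulo null functions. -/
def formsF (q : ℕ) : Submodule ℂ (ℍ →ₘ[volume] ℂ) :=
  higherInvariants (translation.comp Γ.subtype) (parSubgroup Γ) q

/-! ### The Borel-Serre space -/

/-- The preimage of `Γ` in `SL(2, ℤ)`, as a subgroup of `GL(2, ℝ)`. -/
def liftGL : Subgroup (GL (Fin 2) ℝ) :=
  (Γ.comap (QuotientGroup.mk' (Subgroup.center SL(2, ℤ)))).map (Matrix.SpecialLinearGroup.mapGL ℝ)

/-- The space `ℍ_Γ`: the upper half plane with a real line attached to each cusp `c` of `Γ`,
namely the line `ℙ¹(ℝ) ∖ {c}` of (feet of) geodesics ending in `c`. -/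
inductive BorelSerre
  | inner (z : ℍ) : BorelSerre
  | bdry (c x : OnePoint ℝ) (hc : IsCusp c (liftGL Γ)) (hx : x ≠ c) : BorelSerre

/-- At a boundary point on the line of the cusp `c = g ∞`, with foot `g x`, basic neighbourhoods are
the images under `g` of `{|Re z - x| < ε, Im z > 1/ε}` together with the boundary points of
the same line whose foot is `g x'` with `|x' - x| < ε`. In `ℍ` the topology is the usual one. -/
instance : TopologicalSpace (BorelSerre Γ) where
  IsOpen U := IsOpen (BorelSerre.inner ⁻¹' U) ∧
    ∀ (g : SL(2, ℝ)) (x : ℝ) (c p : OnePoint ℝ) (hc : IsCusp c (liftGL Γ)) (hp : p ≠ c),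
      c = (g : GL (Fin 2) ℝ) • OnePoint.infty → p = (g : GL (Fin 2) ℝ) • (x : OnePoint ℝ) →
      BorelSerre.bdry c p hc hp ∈ U → ∃ ε > (0 : ℝ),
        (∀ z : ℍ, |z.re - x| < ε → 1 / ε < z.im → BorelSerre.inner (g • z) ∈ U) ∧
        (∀ (x' : ℝ) (p' : OnePoint ℝ) (hp' : p' ≠ c), |x' - x| < ε →
          p' = (g : GL (Fin 2) ℝ) • (x' : OnePoint ℝ) → BorelSerre.bdry c p' hc hp' ∈ U)
  isOpen_univ := ⟨isOpen_univ, fun _ _ _ _ _ _ _ _ _ => ⟨1, one_pos, by simp, by simp⟩⟩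
  isOpen_inter U V hU hV := by
    refine ⟨hU.1.inter hV.1, fun g x c p hc hp hgc hgp hmem => ?_⟩
    obtain ⟨a, ha, ha1, ha2⟩ := hU.2 g x c p hc hp hgc hgp hmem.1
    obtain ⟨b, hb, hb1, hb2⟩ := hV.2 g x c p hc hp hgc hgp hmem.2
    refine ⟨min a b, lt_min ha hb, fun z h1 h2 => ⟨ha1 z ?_ ?_, hb1 z ?_ ?_⟩,
      fun x' p' hp' h1 h2 => ⟨ha2 x' p' hp' ?_ h2, hb2 x' p' hp' ?_ h2⟩⟩
    · exact h1.trans_le (min_le_left _ _)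
    · exact (one_div_le_one_div_of_le (lt_min ha hb) (min_le_left _ _)).trans_lt h2
    · exact h1.trans_le (min_le_right _ _)
    · exact (one_div_le_one_div_of_le (lt_min ha hb) (min_le_right _ _)).trans_lt h2
    · exact h1.trans_le (min_le_left _ _)
    · exact h1.trans_le (min_le_right _ _)
  isOpen_sUnion 𝒰 h𝒰 := by
    refine ⟨?_, fun g x c p hc hp hgc hgp hmem => ?_⟩
    · rw [Set.preimage_sUnion]
      exact isOpen_biUnion fun U hU => (h𝒰 U hU).1
    · obtain ⟨U, hU, hmem⟩ := hmem
      obtain ⟨a, ha, ha1, ha2⟩ := (h𝒰 U hU).2 g x c p hc hp hgc hgp hmem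
      exact ⟨a, ha, fun z h1 h2 => ⟨U, hU, ha1 z h1 h2⟩,
        fun x' p' hp' h1 h2 => ⟨U, hU, ha2 x' p' hp' h1 h2⟩⟩

/-- The space `L²_loc(ℍ_Γ)`: every point of `ℍ_Γ` has a neighbourhood on which `f` is square
integrable. The measure on `ℍ_Γ` is the hyperbolic measure on `ℍ`, and `ℍ_Γ ∖ ℍ` is a null set, so
that elements are given by functions on `ℍ` modulo null functions. -/
def L2loc : Submodule ℂ (ℍ →ₘ[volume] ℂ) where
  carrier := {f | ∀ p : BorelSerre Γ, ∃ U ∈ 𝓝 p,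
    MemLp f 2 (volume.restrict (BorelSerre.inner ⁻¹' U))}
  add_mem' {f g} hf hg p := by
    obtain ⟨U, hU, hfU⟩ := hf p
    obtain ⟨V, hV, hgV⟩ := hg p
    refine ⟨U ∩ V, Filter.inter_mem hU hV, ?_⟩
    have h1 := hfU.mono_measure (Measure.restrict_mono
      (Set.preimage_mono (Set.inter_subset_left : U ∩ V ⊆ U)) (le_refl (volume : Measure ℍ)))
    have h2 := hgV.mono_measure (Measure.restrict_mono
      (Set.preimage_mono (Set.inter_subset_right : U ∩ V ⊆ V)) (le_refl (volume : Measure ℍ)))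
    exact (memLp_congr_ae (ae_restrict_of_ae (AEEqFun.coeFn_add f g))).mpr (h1.add h2)
  zero_mem' p := by
    refine ⟨Set.univ, Filter.univ_mem, ?_⟩
    exact (memLp_congr_ae (ae_restrict_of_ae
      (AEEqFun.coeFn_zero (α := ℍ) (β := ℂ) (μ := volume)))).mpr MemLp.zero
  smul_mem' a f hf p := by
    obtain ⟨U, hU, hfU⟩ := hf p
    exact ⟨U, hU, (memLp_congr_ae (ae_restrict_of_ae (AEEqFun.coeFn_smul a f))).mpr
      (hfU.const_smul a)⟩

/-- The space `L²_q(Γ \ ℍ)` of all `f ∈ L²_loc(ℍ_Γ)` with `J_{q+1} f = 0`. -/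
def L2q (q : ℕ) : Submodule ℂ (ℍ →ₘ[volume] ℂ) := L2loc Γ ⊓ formsF Γ q

/-! ### Fundamental domains and generators -/

/-- A (complete) geodesic of the hyperbolic plane: a vertical line or a half circle
centred on the real axis. -/
def IsGeodesicLine (L : Set ℍ) : Prop :=
  (∃ a : ℝ, L = {z | z.re = a}) ∨
    ∃ a r : ℝ, 0 < r ∧ L = {z | (z.re - a) ^ 2 + z.im ^ 2 = r ^ 2}

/-- `D` is a closed fundamental domain of `Γ` with finitely many geodesic sides. -/
structure IsClosedFundamentalDomain (D : Set ℍ) : Prop where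
  isClosed : IsClosed D
  covers : ⋃ γ : Γ, γ • D = Set.univ
  disjoint : ∀ γ : Γ, γ ≠ 1 → Disjoint (interior D) (interior (γ • D))
  /-- every point of `ℍ` has a neighbourhood meeting only finitely many translates of `D` -/
  locallyFinite : LocallyFinite fun γ : Γ => γ • D
  /-- the boundary is a finite union of arcs (connected subsets) of geodesics -/
  sides : ∃ A : Set (Set ℍ), A.Finite ∧ frontier D = ⋃₀ A ∧
    ∀ s ∈ A, IsPreconnected s ∧ ∃ L, IsGeodesicLine L ∧ s ⊆ L

/-- A choice of a finite symmetric set of generators `S ∋ 1` of `Γ` and a closed fundamental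
domain `D` with finitely many geodesic sides. -/
structure DomainChoice where
  S : Set Γ
  finite : S.Finite
  one_mem : 1 ∈ S
  symm : ∀ s ∈ S, s⁻¹ ∈ S
  generates : Subgroup.closure S = ⊤
  D : Set ℍ
  isDomain : IsClosedFundamentalDomain Γ D

variable {Γ}

/-- The set `S^q D`, the union of all `s₁ ⋯ s_q D` with `s₁, …, s_q ∈ S`. -/
def DomainChoice.tile (c : DomainChoice Γ) (q : ℕ) : Set ℍ := (c.S ^ q : Set Γ) • c.D

end

open scoped ENNReal NNReal

/-! ### Higher invariants of a normal subgroup, recursively -/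

section HigherInvariants

variable {G : Type*} [Group G] {W : Type*} [AddCommGroup W] [Module ℂ W]

/-! Since `Γ_par` is normal, the condition `J_{q+1} f = 0` unwinds recursively: order 0 means
`Γ`-invariant, and `f` has order `q + 1` exactly if `f` is `Γ_par`-invariant and every `γ f - f` has
order `q` (`mem_higherInvariants_succ_iff`). So `f(s z) = f(z) + (s⁻¹ f - f)(z)` expresses a
translate of `f` by `f` itself and a function of lower order. Induction on `q` and on word length
then bounds `∫ |f|²` over any `γ D` by a constant times `∫ |f|²` over `S^q D`
(`DomainChoice.exists_energy_smul_le`). Uniqueness follows at once.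

The cusps are handled by `Γ_par`. As `D` has finitely many connected sides, it meets only finitely
many translates of the horoball `Im z > 1` (`IsTameDomain.finite_horoballs`). Hence, up to `Γ_par`,
`D` is covered by finitely many compact sets and cuspidal strips, and conversely a horoball by
finitely many translates of `D`. The translates of `D` under `Γ_par` are essentially disjoint and
`f` is `Γ_par`-invariant, so a covering up to `Γ_par` already gives an inequality of square
integrals (`energy_le_of_subset_iUnion`). This compares `S^q D` with `L²_loc(ℍ_Γ)`
(`DomainChoice.mem_L2q_iff`) and any two choices with each other
(`DomainChoice.exists_energy_smul_tile_le`), whence the topology and the continuity of the action.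

For closedness, an `L²` limit on `S^q D` is an a.e. limit of a subsequence, and the same recursion
spreads a.e. convergence to all of `ℍ` (`DomainChoice.ae_tendsto_of_tile`).

The constant `1` separates inner products, because its norm squared is the area of `S^q D`. A
homomorphism `χ` yields the function equal to `χ(γ)` on `γ D`, which has order 1; pairing it with
`1` shows that unitarity forces `χ = 0`. Without such `χ` all `F_q` equal `F_0`, whose elements have
the same square integral over every fundamental domain. -/

theorem single_sub_one_mem_augIdeal (g : G) :
    (MonoidAlgebra.single g 1 - 1 : MonoidAlgebra ℂ G) ∈ augIdeal G := by
  rw [augIdeal, RingHom.mem_ker]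
  simp

/-- Modulo `V` every group element fixes `w`, so `x` acts on `w` through its augmentation. -/
theorem asAlgebraHom_augIdeal_apply_mem (ρ : Representation ℂ G W) (V : Submodule ℂ W) (w : W)
    (h : ∀ g, ρ g w - w ∈ V) {x : MonoidAlgebra ℂ G} (hx : x ∈ augIdeal G) :
    ρ.asAlgebraHom x w ∈ V := by
  have key : ∀ x : MonoidAlgebra ℂ G,
      ρ.asAlgebraHom x w - MonoidAlgebra.lift ℂ ℂ G (1 : G →* ℂ) x • w ∈ V := by
    intro x
    induction x using MonoidAlgebra.induction_linear with
    | zero => simp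
    | add a b ha hb =>
      have := V.add_mem ha hb
      simp only [map_add, LinearMap.add_apply, add_smul]
      convert this using 1
      abel
    | single g c =>
      simp only [Representation.asAlgebraHom_single, LinearMap.smul_apply,
        MonoidAlgebra.lift_single, MonoidHom.one_apply, smul_eq_mul, mul_one, ← smul_sub]
      exact V.smul_mem _ (h g)
  have h0 : MonoidAlgebra.lift ℂ ℂ G (1 : G →* ℂ) x = 0 := hx
  simpa [h0] using key x

theorem mem_higherInvariants_iff (ρ : Representation ℂ G W) (P : Subgroup G) (q : ℕ) (w : W) :
    w ∈ higherInvariants ρ P q ↔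
      (∀ x ∈ augIdeal G ^ (q + 1), ρ.asAlgebraHom x w = 0) ∧ ∀ p ∈ P, ρ p w = w := by
  simp only [higherInvariants, Submodule.mem_iInf, LinearMap.mem_ker]
  constructor
  · intro h
    refine ⟨fun x hx => h x (Ideal.mem_sup_left hx), fun p hp => ?_⟩
    have : (MonoidAlgebra.single p 1 - 1 : MonoidAlgebra ℂ G) ∈ relAugIdeal P := by
      refine Ideal.subset_span ⟨_, single_sub_one_mem_augIdeal (⟨p, hp⟩ : P), ?_⟩
      rw [map_sub, map_one, MonoidAlgebra.mapDomainRingHom_apply, MonoidAlgebra.mapDomain_single]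
      rfl
    have := h _ (Ideal.mem_sup_right this)
    simpa [sub_eq_zero] using this
  · rintro ⟨h1, h2⟩ x hx
    obtain ⟨y, hy, z, hz, rfl⟩ := Submodule.mem_sup.mp hx
    rw [map_add, LinearMap.add_apply, h1 y hy, zero_add]
    clear hx
    refine Submodule.span_induction ?_ (by simp) (fun a b _ _ ha hb => by simp [ha, hb])
      (fun a b _ hb => by simp [hb]) hz
    rintro _ ⟨u, hu, rfl⟩
    let σ : Representation ℂ P W := ρ.comp P.subtype
    have : ∀ u : MonoidAlgebra ℂ P, ρ.asAlgebraHom (MonoidAlgebra.mapDomainRingHom ℂ P.subtype u) =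
        σ.asAlgebraHom u := by
      intro u
      induction u using MonoidAlgebra.induction_linear with
      | zero => simp
      | add a b ha hb => simp only [map_add, ha, hb]
      | single g c => simp [σ]
    rw [this]
    have := asAlgebraHom_augIdeal_apply_mem σ ⊥ w
      (fun g => by simp [σ, h2 g g.2]) hu
    simpa using this

theorem mem_higherInvariants_zero_iff (ρ : Representation ℂ G W) (P : Subgroup G) (w : W) :
    w ∈ higherInvariants ρ P 0 ↔ ∀ g, ρ g w = w := by
  rw [mem_higherInvariants_iff, zero_add, Submodule.pow_one]
  constructor
  · rintro ⟨h, -⟩ g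
    have := h _ (single_sub_one_mem_augIdeal g)
    simpa [sub_eq_zero] using this
  · refine fun h => ⟨fun x hx => ?_, fun p _ => h p⟩
    have := asAlgebraHom_augIdeal_apply_mem ρ ⊥ w (fun g => by simp [h g]) hx
    simpa using this

/-- Write `I^{q+2} = I^{q+1} I` and use that `I` is governed by the elements `g - 1`. Normality
keeps `g w - w` invariant under `P`, as `p g = g (g⁻¹ p g)`. -/
theorem mem_higherInvariants_succ_iff (ρ : Representation ℂ G W) (P : Subgroup G) [P.Normal]
    (q : ℕ) (w : W) :
    w ∈ higherInvariants ρ P (q + 1) ↔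
      (∀ g, ρ g w - w ∈ higherInvariants ρ P q) ∧ ∀ p ∈ P, ρ p w = w := by
  rw [mem_higherInvariants_iff]
  refine and_congr_left fun hP => ?_
  constructor
  · intro h g
    rw [mem_higherInvariants_iff]
    constructor
    · intro x hx
      have := h _ ((Submodule.pow_succ (augIdeal G) (n := q + 1)).symm ▸
        Ideal.mul_mem_mul hx (single_sub_one_mem_augIdeal g))
      simpa using this
    · intro p hp
      have h1 := hP _ (‹P.Normal›.conj_mem p hp g⁻¹)
      have h2 : ρ p (ρ g w) = ρ g w := by
        conv_rhs => rw [← h1]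
        rw [← Module.End.mul_apply, ← Module.End.mul_apply, ← map_mul, ← map_mul]
        congr 2
        group
      rw [map_sub, h2, hP p hp]
  · intro h x hx
    rw [Submodule.pow_succ] at hx
    refine Submodule.smul_induction_on hx (fun a ha b hb => ?_) (fun a b ha hb => by simp [ha, hb])
    have := asAlgebraHom_augIdeal_apply_mem ρ (higherInvariants ρ P q) w h hb
    rw [mem_higherInvariants_iff] at this
    simpa using this.1 a ha

theorem higherInvariants_le_succ (ρ : Representation ℂ G W) (P : Subgroup G) [P.Normal] (q : ℕ) :
    higherInvariants ρ P q ≤ higherInvariants ρ P (q + 1) := by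
  induction q with
  | zero =>
    intro w hw
    rw [mem_higherInvariants_zero_iff] at hw
    rw [mem_higherInvariants_succ_iff]
    exact ⟨fun g => by simp [hw g], fun p _ => hw p⟩
  | succ q ih =>
    intro w hw
    rw [mem_higherInvariants_succ_iff] at hw ⊢
    exact ⟨fun g => ih (hw.1 g), hw.2⟩

theorem higherInvariants_mono (ρ : Representation ℂ G W) (P : Subgroup G) [P.Normal] :
    Monotone (higherInvariants ρ P) :=
  monotone_nat_of_le_succ (higherInvariants_le_succ ρ P)

/-- If `G / P` has no nonzero homomorphism to `ℂ`, then all higher invariants are invariants. -/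
theorem higherInvariants_eq_zero (ρ : Representation ℂ G W) (P : Subgroup G) [P.Normal]
    (h : ∀ χ : G →* Multiplicative ℂ, (∀ p ∈ P, χ p = 1) → χ = 1) (q : ℕ) :
    higherInvariants ρ P q = higherInvariants ρ P 0 := by
  refine le_antisymm ?_ (higherInvariants_mono ρ P (Nat.zero_le q))
  induction q with
  | zero => exact le_rfl
  | succ q ih =>
    intro w hw
    rw [mem_higherInvariants_succ_iff] at hw
    have hinv : ∀ g g', ρ g' (ρ g w - w) = ρ g w - w := fun g =>
      (mem_higherInvariants_zero_iff ρ P _).mp (ih (hw.1 g))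
    rw [mem_higherInvariants_zero_iff]
    intro g
    by_contra hne
    obtain ⟨l, hl⟩ : ∃ l : Module.Dual ℂ W, l (ρ g w - w) ≠ 0 := by
      by_contra! hl
      exact hne (sub_eq_zero.mp ((Module.forall_dual_apply_eq_zero_iff ℂ _).mp hl))
    -- Additivity: `a b w - w = a (b w - w) + (a w - w)`, and `b w - w` is invariant by the
    -- induction hypothesis. The kernel contains `P` because `P` fixes `w`.
    let χ : G →* Multiplicative ℂ :=
      { toFun := fun a => Multiplicative.ofAdd (l (ρ a w - w))
        map_one' := by simp
        map_mul' := fun a b => by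
          rw [← ofAdd_add, ← map_add]
          congr 2
          have := hinv b a
          rw [map_sub, ← Module.End.mul_apply, ← map_mul] at this
          rw [← this]
          abel }
    have hχ := h χ fun p hp => by simp [χ, hw.2 p hp]
    exact hl (congrArg Multiplicative.toAdd (DFunLike.congr_fun hχ g))

end HigherInvariants

/-! ### The modular group -/

section ModularGroup

/-- The class of `z ↦ z + 1` in `PSL(2, ℤ)`. -/
def pslT : PSL(2, ℤ) := ((ModularGroup.T : SL(2, ℤ)) : PSL(2, ℤ))

theorem pslT_zpow (k : ℤ) : pslT ^ k = ((ModularGroup.T ^ k : SL(2, ℤ)) : PSL(2, ℤ)) := rfl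

theorem re_pslT_zpow_smul (k : ℤ) (z : ℍ) : (pslT ^ k • z).re = z.re + k := by
  rw [pslT_zpow, PSL2Z_mk_smul, ModularGroup.re_T_zpow_smul]

theorem im_pslT_zpow_smul (k : ℤ) (z : ℍ) : (pslT ^ k • z).im = z.im := by
  rw [pslT_zpow, PSL2Z_mk_smul, ModularGroup.im_T_zpow_smul]

/-- The standard horoball at `∞`. -/
def horoball : Set ℍ := {z | 1 < z.im}

theorem exists_smul_mem_truncated_or_horoball (z : ℍ) : ∃ γ : PSL(2, ℤ),
    γ • z ∈ ModularGroup.truncatedFundamentalDomain 1 ∨ γ • z ∈ horoball := by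
  obtain ⟨g, hg⟩ := ModularGroup.exists_smul_mem_fd z
  refine ⟨g, ?_⟩
  rw [PSL2Z_mk_smul]
  rcases le_or_gt (g • z).im 1 with h | h
  · exact Or.inl ⟨hg, h⟩
  · exact Or.inr h

theorem SL2Z_eq_of_lower_left_zero (g : SL(2, ℤ)) (h : g 1 0 = 0) :
    ∃ k : ℤ, (g : PSL(2, ℤ)) = pslT ^ k := by
  have hdet := Matrix.det_fin_two (g : Matrix (Fin 2) (Fin 2) ℤ)
  rw [g.det_coe, h, mul_zero, sub_zero] at hdet
  have key : ∀ g : SL(2, ℤ), g 1 0 = 0 → g 0 0 = 1 → g 1 1 = 1 →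
      g = ModularGroup.T ^ (g 0 1) := by
    intro g h0 h1 h2
    ext i j
    rw [ModularGroup.coe_T_zpow]
    fin_cases i <;> fin_cases j <;> simp [h0, h1, h2]
  rcases Int.eq_one_or_neg_one_of_mul_eq_one' hdet.symm with ⟨h1, h2⟩ | ⟨h1, h2⟩
  · exact ⟨g 0 1, by rw [pslT_zpow, ← key g h h1 h2]⟩
  · refine ⟨(-g) 0 1, ?_⟩
    rw [pslT_zpow, ← key (-g) (by simp [h]) (by simp [h1]) (by simp [h2]), QuotientGroup.eq]
    rw [Matrix.SpecialLinearGroup.mem_center_iff]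
    refine ⟨-1, by simp, ?_⟩
    have : g⁻¹ * -g = -1 := by simp
    rw [this]
    ext i j
    fin_cases i <;> fin_cases j <;> simp

/-- If the lower left entry `c` is nonzero, then `|cz + d|² ≥ c² (Im z)² ≥ (Im z)² > Im z`, which
puts the image of `z` below height 1. -/
theorem eq_pslT_zpow_of_mem_horoball {γ : PSL(2, ℤ)} {z : ℍ} (hz : z ∈ horoball)
    (hγ : γ • z ∈ horoball) : ∃ k : ℤ, γ = pslT ^ k := by
  induction γ using QuotientGroup.induction_on with
  | H g =>
    apply SL2Z_eq_of_lower_left_zero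
    by_contra hc
    rw [PSL2Z_mk_smul] at hγ
    have hz' : 1 < z.im := hz
    have hγ' : 1 < (g • z).im := hγ
    rw [ModularGroup.im_smul_eq_div_normSq, lt_div_iff₀
      (UpperHalfPlane.normSq_denom_pos _ z.im_ne_zero), one_mul] at hγ'
    have h1 := UpperHalfPlane.c_mul_im_sq_le_normSq_denom
      (Matrix.SpecialLinearGroup.mapGL ℝ g) z
    have h2 : (1 : ℝ) ≤ ((Matrix.SpecialLinearGroup.mapGL ℝ g) 1 0) ^ 2 := by
      have : (1 : ℤ) ≤ (g 1 0) ^ 2 := by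
        have := sq_nonneg (g 1 0)
        have h3 : (g 1 0) ^ 2 ≠ 0 := pow_ne_zero 2 hc
        omega
      simpa using (by exact_mod_cast this : (1 : ℝ) ≤ ((g 1 0 : ℤ) : ℝ) ^ 2)
    rw [mul_pow] at h1
    have h3 := h1.trans_lt hγ'
    nlinarith [mul_le_mul_of_nonneg_right h2 (sq_nonneg z.im)]

theorem pslT_zpow_smul_horoball (k : ℤ) : pslT ^ k • horoball = horoball := by
  ext z
  rw [Set.mem_smul_set_iff_inv_smul_mem, ← zpow_neg, horoball, Set.mem_ofPred_eq,
    Set.mem_ofPred_eq, im_pslT_zpow_smul]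

theorem smul_horoball_eq_of_inter_nonempty {g h : PSL(2, ℤ)}
    (H : (g • horoball ∩ h • horoball).Nonempty) : g • horoball = h • horoball := by
  obtain ⟨z, hg, hh⟩ := H
  rw [Set.mem_smul_set_iff_inv_smul_mem] at hg hh
  obtain ⟨k, hk⟩ := eq_pslT_zpow_of_mem_horoball (γ := h⁻¹ * g) hg
    (by rwa [mul_smul, smul_inv_smul])
  rw [inv_mul_eq_iff_eq_mul.mp hk, mul_smul, pslT_zpow_smul_horoball]

theorem isOpen_horoball : IsOpen horoball :=
  isOpen_lt continuous_const UpperHalfPlane.continuous_im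

/-- The horoball is the image of `ℍ` under `z ↦ z + i`. -/
theorem isPreconnected_horoball : IsPreconnected horoball := by
  have hc : Continuous fun z : ℍ => (⟨(z : ℂ) + Complex.I, by
      have := z.im_pos
      simpa using by positivity⟩ : ℍ) := by
    rw [UpperHalfPlane.isEmbedding_coe.continuous_iff]
    exact UpperHalfPlane.continuous_coe.add continuous_const
  convert isPreconnected_range hc
  ext z
  constructor
  · intro hz
    have hz' : 1 < z.im := hz
    refine ⟨⟨(z : ℂ) - Complex.I, by simpa using hz'⟩, ?_⟩
    ext1
    simp
  · rintro ⟨w, rfl⟩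
    change 1 < ((w : ℂ) + Complex.I).im
    have := w.im_pos
    rw [Complex.add_im, Complex.I_im]
    linarith [show (w : ℂ).im = w.im from rfl]

instance : Countable SL(2, ℤ) :=
  have : Countable (Matrix (Fin 2) (Fin 2) ℤ) := inferInstanceAs (Countable (Fin 2 → Fin 2 → ℤ))
  Subtype.countable

instance : Countable PSL(2, ℤ) := Quotient.countable

instance : MeasurableConstSMul PSL(2, ℤ) ℍ := ContinuousConstSMul.toMeasurableConstSMul

theorem mapGL_apply_eq_intCast (g : SL(2, ℤ)) (i j : Fin 2) :
    (Matrix.SpecialLinearGroup.mapGL ℝ g) i j = ((g i j : ℤ) : ℝ) := by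
  simp

theorem mapGL_T_pow_isParabolic {k : ℤ} (hk : k ≠ 0) (h : SL(2, ℤ)) :
    (Matrix.SpecialLinearGroup.mapGL ℝ (h * ModularGroup.T ^ k * h⁻¹)).IsParabolic := by
  rw [map_mul, map_mul, map_inv, Matrix.GeneralLinearGroup.isParabolic_conj_iff,
    Matrix.GeneralLinearGroup.isParabolic_iff_of_upperTriangular]
  · simp only [mapGL_apply_eq_intCast, ModularGroup.coe_T_zpow]
    simp [hk]
  · rw [mapGL_apply_eq_intCast, ModularGroup.coe_T_zpow]
    simp

variable {Γ : Subgroup PSL(2, ℤ)}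

theorem mem_parSubgroup_of_conj_pslT {h : PSL(2, ℤ)} {k : ℤ} {γ : Γ}
    (hγ : (γ : PSL(2, ℤ)) = h * pslT ^ k * h⁻¹) : γ ∈ parSubgroup Γ := by
  rcases eq_or_ne k 0 with rfl | hk
  · have : γ = 1 := by
      ext1
      rw [hγ]
      simp
    rw [this]
    exact one_mem _
  · induction h using QuotientGroup.induction_on with
    | H h =>
      exact Subgroup.subset_closure ⟨h * ModularGroup.T ^ k * h⁻¹, hγ.symm,
        mapGL_T_pow_isParabolic hk h⟩

/-- Conjugates of parabolic elements are parabolic. Conjugation by all of `Γ(1)` is allowed, so that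
`Γ(1)` will preserve `F_q`. -/
theorem conj_mem_parSubgroup [Γ.Normal] (g : PSL(2, ℤ)) {p : Γ} (hp : p ∈ parSubgroup Γ) :
    MulAut.conjNormal g p ∈ parSubgroup Γ := by
  have : parSubgroup Γ ≤ (parSubgroup Γ).comap (MulAut.conjNormal g : Γ ≃* Γ).toMonoidHom := by
    conv_lhs => rw [parSubgroup]
    rw [Subgroup.closure_le]
    rintro γ ⟨a, ha, hpar⟩
    induction g using QuotientGroup.induction_on with
    | H g =>
      refine Subgroup.subset_closure ⟨g * a * g⁻¹, ?_, ?_⟩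
      · change _ = ((MulAut.conjNormal (g : PSL(2, ℤ)) γ : Γ) : PSL(2, ℤ))
        rw [MulAut.conjNormal_apply, ← ha]
        rfl
      · rw [map_mul, map_mul, map_inv, Matrix.GeneralLinearGroup.isParabolic_conj_iff]
        exact hpar
  exact this hp

instance [Γ.Normal] : (parSubgroup Γ).Normal where
  conj_mem p hp g := by
    convert conj_mem_parSubgroup (g : PSL(2, ℤ)) hp
    ext1
    simp

/-- The index serves as a common period for all cusps; it need not be the width of any of them. -/
theorem conj_pslT_index_mem [Γ.Normal] (h : PSL(2, ℤ)) (k : ℤ) :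
    h * pslT ^ (Γ.index * k) * h⁻¹ ∈ Γ := by
  refine ‹Γ.Normal›.conj_mem _ ?_ h
  rw [zpow_mul, zpow_natCast]
  exact zpow_mem (Γ.pow_index_mem pslT) k

end ModularGroup

/-! ### Fundamental domains -/

section TameDomain

theorem exists_truncated_or_horoball (z : ℍ) : ∃ g : PSL(2, ℤ),
    z ∈ g • ModularGroup.truncatedFundamentalDomain 1 ∨ z ∈ g • horoball := by
  obtain ⟨g, hg⟩ := exists_smul_mem_truncated_or_horoball z
  exact ⟨g⁻¹, by simpa only [Set.mem_smul_set_iff_inv_smul_mem, inv_inv] using hg⟩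

/-- The topological part of the properties of a closed fundamental domain with finitely many
geodesic sides. -/
structure IsTameDomain (Γ : Subgroup PSL(2, ℤ)) (D : Set ℍ) : Prop where
  isClosed : IsClosed D
  covers : ⋃ γ : Γ, γ • D = Set.univ
  disjoint : ∀ γ : Γ, γ ≠ 1 → Disjoint (interior D) (interior (γ • D))
  locallyFinite : LocallyFinite fun γ : Γ => γ • D
  frontier_null : volume (frontier D) = 0
  sides : ∃ A : Set (Set ℍ), A.Finite ∧ frontier D = ⋃₀ A ∧ ∀ s ∈ A, IsPreconnected s

theorem volume_eq_zero_of_image_coe {s : Set ℍ}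
    (h : volume (UpperHalfPlane.coe '' s : Set ℂ) = 0) : volume s = 0 := by
  rw [UpperHalfPlane.volume_eq_lintegral]
  exact setLIntegral_measure_zero _ _ h

theorem IsGeodesicLine.volume_eq_zero {L : Set ℍ} (hL : IsGeodesicLine L) : volume L = 0 := by
  refine volume_eq_zero_of_image_coe ?_
  rcases hL with ⟨a, rfl⟩ | ⟨a, r, hr, rfl⟩
  · have h : volume ({a} ×ˢ Set.univ : Set (ℝ × ℝ)) = 0 := by
      rw [Measure.volume_eq_prod, Measure.prod_prod]
      simp
    rw [← Complex.volume_preserving_equiv_real_prod.measure_preimage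
      ((measurableSet_singleton a).prod MeasurableSet.univ).nullMeasurableSet] at h
    refine measure_mono_null ?_ h
    rintro _ ⟨z, hz, rfl⟩
    simpa using hz
  · refine measure_mono_null ?_ (Measure.addHaar_sphere (volume : Measure ℂ) (a : ℂ) r)
    rintro _ ⟨z, hz, rfl⟩
    rw [mem_sphere_iff_norm, ← sq_eq_sq₀ (norm_nonneg _) hr.le, ← Complex.normSq_eq_norm_sq,
      Complex.normSq_apply]
    have : (z.re - a) ^ 2 + z.im ^ 2 = r ^ 2 := hz
    simpa [sq] using this

/-- Only two consequences of geodesic sides matter below: the boundary is a null set, and it is a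
finite union of connected sets. -/
theorem IsClosedFundamentalDomain.isTameDomain {Γ : Subgroup PSL(2, ℤ)} {D : Set ℍ}
    (h : IsClosedFundamentalDomain Γ D) : IsTameDomain Γ D where
  isClosed := h.isClosed
  covers := h.covers
  disjoint := h.disjoint
  locallyFinite := h.locallyFinite
  frontier_null := by
    obtain ⟨A, hA, hD, hs⟩ := h.sides
    rw [hD, measure_sUnion_null_iff hA.countable]
    intro s hsA
    obtain ⟨-, L, hL, hsL⟩ := hs s hsA
    exact measure_mono_null hsL hL.volume_eq_zero
  sides := by
    obtain ⟨A, hA, hD, hs⟩ := h.sides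
    exact ⟨A, hA, hD, fun s hsA => (hs s hsA).1⟩

namespace IsTameDomain

variable {Γ : Subgroup PSL(2, ℤ)} {D : Set ℍ}

theorem exists_mem_smul (h : IsTameDomain Γ D) (z : ℍ) : ∃ γ : Γ, z ∈ γ • D := by
  have := h.covers.symm ▸ Set.mem_univ z
  simpa using this

theorem nullMeasurableSet_smul (h : IsTameDomain Γ D) (g : PSL(2, ℤ)) :
    NullMeasurableSet (g • D) := (h.isClosed.smul g).measurableSet.nullMeasurableSet

theorem aedisjoint (h : IsTameDomain Γ D) {γ : Γ} (hγ : γ ≠ 1) : AEDisjoint volume D (γ • D) := by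
  have h1 : volume (frontier D ∪ (γ : PSL(2, ℤ)) • frontier D) = 0 := by
    rw [measure_union_null_iff, measure_smul]
    exact ⟨h.frontier_null, h.frontier_null⟩
  refine measure_mono_null ?_ h1
  rintro z ⟨hz1, hz2⟩
  by_contra hz
  rw [Set.mem_union, not_or] at hz
  have e : (γ : PSL(2, ℤ)) • interior D = interior (γ • D) := (interior_smul _ _).symm
  have hz3 : z ∈ interior D := by
    by_contra h3
    exact hz.1 ⟨subset_closure hz1, h3⟩
  have hz4 : z ∈ interior (γ • D) := by
    by_contra h3
    rw [← e, Set.mem_smul_set_iff_inv_smul_mem] at h3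
    refine hz.2 (Set.mem_smul_set_iff_inv_smul_mem.mpr ⟨subset_closure ?_, h3⟩)
    exact Set.mem_smul_set_iff_inv_smul_mem.mp hz2
  exact Set.disjoint_left.mp (h.disjoint γ hγ) hz3 hz4

theorem isFundamentalDomain (h : IsTameDomain Γ D) : IsFundamentalDomain Γ D volume := by
  refine IsFundamentalDomain.mk'' h.isClosed.measurableSet.nullMeasurableSet ?_ ?_ ?_
  · refine Filter.Eventually.of_forall fun z => ?_
    obtain ⟨γ, hγ⟩ := h.exists_mem_smul z
    exact ⟨γ⁻¹, Set.mem_smul_set_iff_inv_smul_mem.mp hγ⟩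
  · exact fun g hg => (h.aedisjoint hg).symm
  · exact fun g => (measurePreserving_smul (g : PSL(2, ℤ)) volume).quasiMeasurePreserving

/-- By normality `γ g D = g γ' D` with `γ' = g⁻¹ γ g` in `Γ`. -/
theorem smul [Γ.Normal] (h : IsTameDomain Γ D) (g : PSL(2, ℤ)) : IsTameDomain Γ (g • D) := by
  have e : ∀ γ : Γ, γ • g • D = g • (MulAut.conjNormal g⁻¹ γ : Γ) • D := fun γ => by
    change (γ : PSL(2, ℤ)) • g • D = g • ((MulAut.conjNormal g⁻¹ γ : Γ) : PSL(2, ℤ)) • D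
    rw [MulAut.conjNormal_apply, smul_smul, smul_smul]
    congr 1
    group
  refine ⟨h.isClosed.smul g, ?_, ?_, ?_, ?_, ?_⟩
  · simp_rw [e]
    rw [(MulAut.conjNormal g⁻¹ : Γ ≃* Γ).surjective.iUnion_comp (fun γ : Γ => g • γ • D),
      ← Set.smul_set_iUnion, h.covers, Set.smul_set_univ]
  · intro γ hγ
    rw [e, interior_smul, interior_smul, Set.disjoint_smul_set]
    exact h.disjoint _ (by simpa using hγ)
  · simp_rw [e]
    refine LocallyFinite.comp_injective (g := (MulAut.conjNormal g⁻¹ : Γ ≃* Γ))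
      (f := fun γ : Γ => g • γ • D) ?_ (MulEquiv.injective _)
    have := h.locallyFinite.preimage_continuous (g := fun z : ℍ => g⁻¹ • z)
      (continuous_const_smul _)
    simpa only [Set.preimage_smul_inv] using this
  · have : frontier (g • D) = g • frontier D := ((Homeomorph.smul g).image_frontier D).symm
    rw [this, measure_smul, h.frontier_null]
  · obtain ⟨A, hA, hD, hs⟩ := h.sides
    refine ⟨(fun s => g • s) '' A, hA.image _, ?_, ?_⟩
    · have : frontier (g • D) = g • frontier D := ((Homeomorph.smul g).image_frontier D).symm
      rw [this, hD, Set.sUnion_image, Set.sUnion_eq_biUnion]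
      simp only [Set.smul_set_iUnion]
    · rintro _ ⟨s, hsA, rfl⟩
      exact (hs s hsA).image _ (continuous_const_smul g).continuousOn

/-- A compact set is covered by finitely many translates of `D`. -/
theorem isCompact_subset (h : IsTameDomain Γ D) {K : Set ℍ} (hK : IsCompact K) :
    ∃ F : Set Γ, F.Finite ∧ K ⊆ ⋃ γ ∈ F, γ • D := by
  refine ⟨_, h.locallyFinite.finite_nonempty_inter_compact hK, fun z hz => ?_⟩
  obtain ⟨γ, hγ⟩ := h.exists_mem_smul z
  exact Set.mem_biUnion (show _ from ⟨z, hγ, hz⟩) hγ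

/-- A nontrivial parabolic element `γ` of `Γ` stabilises the horoball, which would therefore lie in
the interiors of both `D` and `γ D`. -/
theorem not_horoball_subset [Γ.Normal] (h : IsTameDomain Γ D) (hΓ : Γ.index ≠ 0) (g : PSL(2, ℤ)) :
    ¬ g • horoball ⊆ D := by
  intro hsub
  have hsub' : g • horoball ⊆ interior D :=
    interior_maximal hsub (isOpen_horoball.smul g)
  let γ : Γ := ⟨_, conj_pslT_index_mem (Γ := Γ) g 1⟩
  have hγ : γ ≠ 1 := by
    intro h1
    have h2 : g * pslT ^ ((Γ.index : ℤ) * 1) * g⁻¹ = 1 := congrArg Subtype.val h1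
    rw [conj_eq_one_iff] at h2
    have h3 := re_pslT_zpow_smul ((Γ.index : ℤ) * 1) UpperHalfPlane.I
    rw [h2, one_smul] at h3
    simp at h3
    exact hΓ (by exact_mod_cast h3.symm)
  have hinv : γ • g • horoball = g • horoball := by
    change (g * pslT ^ ((Γ.index : ℤ) * 1) * g⁻¹) • g • horoball = _
    rw [smul_smul, inv_mul_cancel_right, mul_smul, pslT_zpow_smul_horoball]
  have hsub2 : g • horoball ⊆ interior (γ • D) := by
    rw [← hinv]
    exact interior_maximal (Set.smul_set_mono hsub)
      ((isOpen_horoball.smul g).smul (γ : PSL(2, ℤ)))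
  have hne : (g • horoball).Nonempty := by
    refine Set.Nonempty.smul_set ⟨⟨⟨0, 2⟩, by simp⟩, ?_⟩
    change (1 : ℝ) < 2
    norm_num
  obtain ⟨z, hz⟩ := hne
  exact Set.disjoint_left.mp (h.disjoint γ hγ) (hsub' hz) (hsub2 hz)

variable [Γ.Normal] [Γ.FiniteIndex]

/-- A compact set meets only finitely many translates of `D` by `Γ`, even after moving it
by `PSL(2, ℤ)`. -/
theorem finite_smul_inter (h : IsTameDomain Γ D) {K : Set ℍ} (hK : IsCompact K) :
    {g : PSL(2, ℤ) | (g • K ∩ D).Nonempty}.Finite := by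
  have h1 : ∀ r : PSL(2, ℤ), {γ : Γ | (γ • D ∩ r • K).Nonempty}.Finite := fun r =>
    h.locallyFinite.finite_nonempty_inter_compact (hK.smul r)
  -- With `r` the chosen representative of the coset `g⁻¹ Γ`, one has `g = γ⁻¹ r⁻¹` for some `γ ∈
  -- Γ`, and `γ D` meets the compact set `r⁻¹ K`. There are finitely many cosets.
  have h2 := Set.finite_iUnion fun c : PSL(2, ℤ) ⧸ Γ =>
    (h1 c.out⁻¹).image (fun γ : Γ => (γ : PSL(2, ℤ))⁻¹ * c.out⁻¹)
  refine h2.subset fun g hg => ?_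
  obtain ⟨z, hz1, hz2⟩ := hg
  have hmem : g * ((g⁻¹ : PSL(2, ℤ)) : PSL(2, ℤ) ⧸ Γ).out ∈ Γ := by
    have : (((g⁻¹ : PSL(2, ℤ))) : PSL(2, ℤ) ⧸ Γ) =
      ((((g⁻¹ : PSL(2, ℤ)) : PSL(2, ℤ) ⧸ Γ).out : PSL(2, ℤ)) : PSL(2, ℤ) ⧸ Γ) :=
        (Quotient.out_eq' _).symm
    rw [QuotientGroup.eq, inv_inv] at this
    exact this
  refine Set.mem_iUnion.mpr ⟨((g⁻¹ : PSL(2, ℤ)) : PSL(2, ℤ) ⧸ Γ), ⟨_, hmem⟩⁻¹,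
    ⟨(⟨_, hmem⟩ : Γ)⁻¹ • z, Set.smul_mem_smul_set hz2, ?_⟩, by simp⟩
  rw [Set.mem_smul_set_iff_inv_smul_mem] at hz1 ⊢
  change (_ : PSL(2, ℤ))⁻¹ • (g * _)⁻¹ • z ∈ K
  rw [smul_smul]
  convert hz1 using 2
  group

/-- `D` meets only finitely many horoballs. -/
theorem finite_horoballs (h : IsTameDomain Γ D) :
    {B : Set ℍ | (∃ g : PSL(2, ℤ), B = g • horoball) ∧ (D ∩ B).Nonempty}.Finite := by
  obtain ⟨A, hA, hD, hs⟩ := h.sides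
  have h1 : ((fun g : PSL(2, ℤ) => g • horoball) ''
      {g | (g • ModularGroup.truncatedFundamentalDomain 1 ∩ D).Nonempty}).Finite :=
    (h.finite_smul_inter (ModularGroup.isCompact_truncatedFundamentalDomain 1)).image _
  have h2 : (⋃ s ∈ A, {B : Set ℍ | (∃ g : PSL(2, ℤ), B = g • horoball) ∧ s ⊆ B ∧
      s.Nonempty}).Finite := by
    refine hA.biUnion fun s _ => Set.Subsingleton.finite ?_
    rintro _ ⟨⟨g, rfl⟩, hg, z, hz⟩ _ ⟨⟨g', rfl⟩, hg', -⟩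
    exact smul_horoball_eq_of_inter_nonempty ⟨z, hg hz, hg' hz⟩
  refine (h1.union h2).subset ?_
  rintro _ ⟨⟨g, rfl⟩, hne⟩
  -- If `D` meets the bounding horocycle, a power of `T` moves the meeting point into a translate of
  -- a compact set, and finitely many of these meet `D`. Otherwise the connected horoball meets `D`
  -- without lying in it, so it meets a side. That side cannot cross the horocycle, hence lies
  -- wholly in this horoball, and in no other one because distinct horoballs are disjoint. There are
  -- finitely many sides.
  by_cases hb : ∃ z ∈ D, (g⁻¹ • z).im = 1
  · left
    obtain ⟨z, hz, hz1⟩ := hb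
    refine ⟨g * pslT ^ (round (g⁻¹ • z).re), ⟨z, ?_, hz⟩, ?_⟩
    · rw [Set.mem_smul_set_iff_inv_smul_mem, mul_inv_rev, mul_smul, ← zpow_neg]
      have hre : |(pslT ^ (-round (g⁻¹ • z).re) • g⁻¹ • z).re| ≤ 1 / 2 := by
        rw [re_pslT_zpow_smul, Int.cast_neg, ← sub_eq_add_neg]
        exact abs_sub_round _
      refine ⟨⟨?_, hre⟩, ?_⟩
      · rw [Complex.normSq_apply]
        change 1 ≤ (_ : ℍ).re * (_ : ℍ).re + (_ : ℍ).im * (_ : ℍ).im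
        rw [im_pslT_zpow_smul, hz1]
        nlinarith [mul_self_nonneg (pslT ^ (-round (g⁻¹ • z).re) • g⁻¹ • z).re]
      · rw [im_pslT_zpow_smul, hz1]
    · change (g * _) • horoball = _
      rw [mul_smul, pslT_zpow_smul_horoball]
  · right
    push Not at hb
    have hpre : IsPreconnected (g • horoball) :=
      isPreconnected_horoball.image _ (continuous_const_smul g).continuousOn
    obtain ⟨z, hzB, hzD⟩ : (g • horoball ∩ frontier D).Nonempty := by
      by_contra hf
      have hsub : g • horoball ⊆ interior D ∪ Dᶜ := fun z hz => by
        by_contra hzn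
        rw [Set.mem_union, Set.mem_compl_iff, not_or, not_not] at hzn
        exact hf ⟨z, hz, subset_closure hzn.2, hzn.1⟩
      obtain ⟨w, hwD, hwB⟩ := hne
      obtain ⟨v, hvB, hvD⟩ := Set.not_subset.mp
        (h.not_horoball_subset Subgroup.FiniteIndex.index_ne_zero g)
      obtain ⟨u, -, hu1, hu2⟩ := hpre _ _ isOpen_interior h.isClosed.isOpen_compl hsub
        ⟨w, hwB, (hsub hwB).resolve_right fun hn => hn hwD⟩ ⟨v, hvB, hvD⟩
      exact hu2 (interior_subset hu1)
    rw [hD] at hzD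
    obtain ⟨s, hsA, hzs⟩ := hzD
    refine Set.mem_biUnion hsA ⟨⟨g, rfl⟩, fun w hw => ?_, z, hzs⟩
    by_contra hwB
    rw [Set.mem_smul_set_iff_inv_smul_mem] at hwB hzB
    have hc : ContinuousOn (fun z : ℍ => (g⁻¹ • z).im) s :=
      (UpperHalfPlane.continuous_im.comp (continuous_const_smul g⁻¹)).continuousOn
    obtain ⟨v, hv, hv1⟩ := (hs s hsA).intermediate_value hw hzs hc
      (show (1 : ℝ) ∈ Set.Icc _ _ from ⟨not_lt.mp hwB, le_of_lt hzB⟩)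
    have hvD : v ∈ D := h.isClosed.frontier_subset (hD ▸ Set.mem_sUnion_of_mem hv hsA)
    exact hb v hvD hv1

/-- Up to parabolic elements, `D` is covered by finitely many compact sets and cuspidal strips. -/
theorem subset_iUnion_parSubgroup (h : IsTameDomain Γ D) : ∃ F₁ F₂ : Set PSL(2, ℤ),
    F₁.Finite ∧ F₂.Finite ∧ D ⊆ ⋃ p : parSubgroup Γ, p •
      ((⋃ g ∈ F₁, g • ModularGroup.truncatedFundamentalDomain 1) ∪
        ⋃ g ∈ F₂, g • {z : ℍ | |z.re| ≤ Γ.index ∧ 1 < z.im}) := by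
  classical
  -- Infinitely many `g` give the same horoball; `φ` picks one for each, so that finitely many
  -- horoballs give finitely many group elements.
  let φ : Set ℍ → PSL(2, ℤ) := fun B =>
    if hB : ∃ g : PSL(2, ℤ), B = g • horoball then hB.choose else 1
  have hφ : ∀ g : PSL(2, ℤ), g • horoball = φ (g • horoball) • horoball := fun g => by
    have hB : ∃ g' : PSL(2, ℤ), g • horoball = g' • horoball := ⟨g, rfl⟩
    simp only [φ, dif_pos hB]
    exact hB.choose_spec
  refine ⟨_, φ '' _, h.finite_smul_inter (ModularGroup.isCompact_truncatedFundamentalDomain 1),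
    h.finite_horoballs.image _, fun z hz => ?_⟩
  obtain ⟨g, hg | hg⟩ := exists_truncated_or_horoball z
  · refine Set.mem_iUnion.mpr ⟨1, ?_⟩
    rw [one_smul]
    exact Or.inl (Set.mem_biUnion (show _ from ⟨z, hg, hz⟩) hg)
  · have hg' := hg
    rw [hφ, Set.mem_smul_set_iff_inv_smul_mem] at hg
    set g' := φ (g • horoball) with hg'_def
    have hN : (0 : ℝ) < Γ.index := by
      exact_mod_cast Nat.pos_of_ne_zero Subgroup.FiniteIndex.index_ne_zero
    -- Translation by `-k` times the index brings the real part into `[0, index)`.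
    let k : ℤ := ⌊(g'⁻¹ • z).re / Γ.index⌋
    let γ : Γ := ⟨_, conj_pslT_index_mem g' k⟩
    have hγ : γ ∈ parSubgroup Γ := mem_parSubgroup_of_conj_pslT rfl
    refine Set.mem_iUnion.mpr ⟨⟨γ, hγ⟩, Set.mem_smul_set_iff_inv_smul_mem.mpr (Or.inr ?_)⟩
    refine Set.mem_biUnion (x := g') ⟨_, ⟨⟨g, rfl⟩, z, hz, hg'⟩, rfl⟩ ?_
    rw [Set.mem_smul_set_iff_inv_smul_mem]
    change g'⁻¹ • (g' * pslT ^ (Γ.index * k) * g'⁻¹)⁻¹ • z ∈ _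
    have e : g'⁻¹ • (g' * pslT ^ (Γ.index * k) * g'⁻¹)⁻¹ • z =
        pslT ^ (-(Γ.index * k)) • g'⁻¹ • z := by
      rw [smul_smul, smul_smul]
      congr 1
      group
    rw [e]
    have h1 := Int.floor_le ((g'⁻¹ • z).re / Γ.index)
    have h2 := Int.lt_floor_add_one ((g'⁻¹ • z).re / Γ.index)
    rw [le_div_iff₀ hN] at h1
    rw [div_lt_iff₀ hN] at h2
    refine ⟨?_, ?_⟩
    · rw [re_pslT_zpow_smul, abs_le]
      push_cast
      constructor <;> nlinarith
    · rw [im_pslT_zpow_smul]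
      exact hg

/-- Up to parabolic elements, a horoball is covered by finitely many translates of `D`. -/
theorem smul_horoball_subset (h : IsTameDomain Γ D) (g : PSL(2, ℤ)) : ∃ F : Set Γ, F.Finite ∧
    g • horoball ⊆ ⋃ p : parSubgroup Γ, p • ⋃ γ ∈ F, γ • D := by
  classical
  -- One `γ` is chosen for each horoball `γ⁻¹ g H` (`H` the standard one); only the finitely many
  -- that meet `D` matter.
  let φ : Set ℍ → Γ := fun B =>
    if hB : ∃ γ : Γ, (γ⁻¹ : PSL(2, ℤ)) • g • horoball = B then hB.choose else 1
  have hφ : ∀ γ : Γ, ((φ ((γ⁻¹ : PSL(2, ℤ)) • g • horoball) : PSL(2, ℤ)))⁻¹ • g • horoball =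
      (γ⁻¹ : PSL(2, ℤ)) • g • horoball := fun γ => by
    have hB : ∃ γ' : Γ, (γ'⁻¹ : PSL(2, ℤ)) • g • horoball = (γ⁻¹ : PSL(2, ℤ)) • g • horoball :=
      ⟨γ, rfl⟩
    simp only [φ, dif_pos hB]
    exact hB.choose_spec
  refine ⟨φ '' _, h.finite_horoballs.image _, fun z hz => ?_⟩
  obtain ⟨γ, hγ⟩ := h.exists_mem_smul z
  set B := (γ⁻¹ : PSL(2, ℤ)) • g • horoball with hB
  have hzD : γ⁻¹ • z ∈ D := Set.mem_smul_set_iff_inv_smul_mem.mp hγ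
  have hzB : γ⁻¹ • z ∈ B := Set.smul_mem_smul_set (a := (γ⁻¹ : PSL(2, ℤ))) hz
  -- Both `γ⁻¹` and `(φ B)⁻¹` carry `g H` to `B`, so `γ (φ B)⁻¹` stabilises `g H` and is conjugate
  -- by `g` to a power of `T`.
  have hpar : γ * (φ B)⁻¹ ∈ parSubgroup Γ := by
    have h1 : (γ : PSL(2, ℤ))⁻¹ • z ∈ (φ B : PSL(2, ℤ))⁻¹ • g • horoball := by
      rw [hB, hφ γ]
      exact hzB
    rw [Set.mem_smul_set_iff_inv_smul_mem, Set.mem_smul_set_iff_inv_smul_mem, inv_inv] at h1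
    obtain ⟨k, hk⟩ := eq_pslT_zpow_of_mem_horoball
      (γ := g⁻¹ * (φ B : PSL(2, ℤ)) * (γ : PSL(2, ℤ))⁻¹ * g)
      (Set.mem_smul_set_iff_inv_smul_mem.mp hz) (by
        convert h1 using 1
        simp only [smul_smul]
        congr 1
        group)
    refine mem_parSubgroup_of_conj_pslT (h := g) (k := -k) ?_
    rw [zpow_neg, ← hk]
    push_cast
    group
  refine Set.mem_iUnion.mpr ⟨⟨_, hpar⟩, Set.mem_smul_set_iff_inv_smul_mem.mpr ?_⟩
  refine Set.mem_biUnion (x := φ B) ⟨B, ⟨⟨(γ : PSL(2, ℤ))⁻¹ * g, by rw [hB, mul_smul]⟩, _, hzD, hzB⟩, rfl⟩ ?_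
  rw [Set.mem_smul_set_iff_inv_smul_mem]
  convert hzD using 1
  change (φ B)⁻¹ • (γ * (φ B)⁻¹)⁻¹ • z = _
  rw [smul_smul]
  congr 1
  group

/-- Two fundamental domains are contained in each other up to parabolic elements and finitely many
translates. -/
theorem subset_iUnion_smul {D' : Set ℍ} (h : IsTameDomain Γ D) (h' : IsTameDomain Γ D') :
    ∃ F : Set Γ, F.Finite ∧ D' ⊆ ⋃ p : parSubgroup Γ, p • ⋃ γ ∈ F, γ • D := by
  obtain ⟨F₁, F₂, hF₁, hF₂, hsub⟩ := h'.subset_iUnion_parSubgroup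
  choose K hK hK' using fun g : PSL(2, ℤ) =>
    h.isCompact_subset ((ModularGroup.isCompact_truncatedFundamentalDomain 1).smul g)
  choose C hC hC' using h.smul_horoball_subset
  refine ⟨(⋃ g ∈ F₁, K g) ∪ ⋃ g ∈ F₂, C g, (hF₁.biUnion fun g _ => hK g).union
    (hF₂.biUnion fun g _ => hC g), fun z hz => ?_⟩
  obtain ⟨p, hp⟩ := Set.mem_iUnion.mp (hsub hz)
  rw [Set.mem_smul_set_iff_inv_smul_mem] at hp
  rcases hp with hp | hp
  · obtain ⟨g, hg, hp⟩ := Set.mem_iUnion₂.mp hp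
    obtain ⟨γ, hγ, hp⟩ := Set.mem_iUnion₂.mp (hK' g hp)
    exact Set.mem_iUnion.mpr ⟨p, Set.mem_smul_set_iff_inv_smul_mem.mpr
      (Set.mem_biUnion (Or.inl (Set.mem_biUnion hg hγ)) hp)⟩
  · obtain ⟨g, hg, hp⟩ := Set.mem_iUnion₂.mp hp
    have hp' : p⁻¹ • z ∈ g • horoball :=
      Set.smul_set_mono (s := {z : ℍ | |z.re| ≤ Γ.index ∧ 1 < z.im}) (fun w hw => hw.2) hp
    obtain ⟨p', hp'⟩ := Set.mem_iUnion.mp (hC' g hp')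
    rw [Set.mem_smul_set_iff_inv_smul_mem] at hp'
    obtain ⟨γ, hγ, hp'⟩ := Set.mem_iUnion₂.mp hp'
    refine Set.mem_iUnion.mpr ⟨p * p', Set.mem_smul_set_iff_inv_smul_mem.mpr ?_⟩
    rw [mul_inv_rev, mul_smul]
    exact Set.mem_biUnion (Or.inr (Set.mem_biUnion hg hγ)) hp'

end IsTameDomain

end TameDomain

/-! ### Square integrals over subsets of the upper half plane -/

section Energy

/-- The square of the `L²`-seminorm of `f` on `A`. -/
noncomputable def energy (A : Set ℍ) (f : ℍ →ₘ[volume] ℂ) : ℝ≥0∞ :=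
  ∫⁻ z in A, ‖f z‖ₑ ^ (2 : ℝ)

theorem memLp_two_restrict_iff (A : Set ℍ) (f : ℍ →ₘ[volume] ℂ) :
    MemLp f 2 (volume.restrict A) ↔ energy A f < ∞ := by
  have h : AEStronglyMeasurable f (volume.restrict A) := f.aestronglyMeasurable.restrict
  rw [MemLp, and_iff_right h, eLpNorm_lt_top_iff_lintegral_rpow_enorm_lt_top two_ne_zero
    ENNReal.ofNat_ne_top]
  simp [energy]

theorem eLpNorm_two_restrict (A : Set ℍ) (f : ℍ →ₘ[volume] ℂ) :
    eLpNorm f 2 (volume.restrict A) ^ 2 = energy A f := by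
  rw [eLpNorm_eq_lintegral_rpow_enorm_toReal two_ne_zero ENNReal.ofNat_ne_top, ENNReal.toReal_ofNat,
    ← ENNReal.rpow_natCast, ← ENNReal.rpow_mul]
  simp [energy]

theorem energy_mono {A B : Set ℍ} (h : A ⊆ B) (f : ℍ →ₘ[volume] ℂ) : energy A f ≤ energy B f :=
  lintegral_mono_set h

theorem energy_iUnion_le {ι : Type*} [Countable ι] (A : ι → Set ℍ) (f : ℍ →ₘ[volume] ℂ) :
    energy (⋃ i, A i) f ≤ ∑' i, energy (A i) f :=
  lintegral_iUnion_le _ _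

theorem energy_biUnion_le {ι : Type*} (F : Finset ι) (A : ι → Set ℍ) (f : ℍ →ₘ[volume] ℂ) :
    energy (⋃ i ∈ F, A i) f ≤ ∑ i ∈ F, energy (A i) f := by
  rw [← F.tsum_subtype]
  have : ⋃ i ∈ F, A i = ⋃ i : F, A i := (Set.iUnion_subtype (· ∈ F) fun i => A i.1).symm
  rw [this]
  exact energy_iUnion_le _ _

theorem energy_union_le (A B : Set ℍ) (f : ℍ →ₘ[volume] ℂ) :
    energy (A ∪ B) f ≤ energy A f + energy B f :=
  lintegral_union_le _ _ _

theorem energy_translation (γ : PSL(2, ℤ)) (A : Set ℍ) (f : ℍ →ₘ[volume] ℂ) :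
    energy A (translation γ f) = energy (γ⁻¹ • A) f := by
  have h := (measurePreserving_smul γ⁻¹ (volume : Measure ℍ)).setLIntegral_comp_preimage_emb
    (measurableEmbedding_const_smul γ⁻¹) (fun z => ‖f z‖ₑ ^ (2 : ℝ)) (γ⁻¹ • A)
  rw [Set.preimage_smul_inv, smul_inv_smul] at h
  rw [energy, energy, ← h]
  refine lintegral_congr_ae (ae_restrict_of_ae ?_)
  filter_upwards [translation_ae γ f] with z hz
  rw [hz]

theorem energy_add_le (A : Set ℍ) (f g : ℍ →ₘ[volume] ℂ) :
    energy A (f + g) ≤ 2 * (energy A f + energy A g) := by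
  have h : ∀ᵐ z ∂(volume.restrict A),
      ‖(f + g : ℍ →ₘ[volume] ℂ) z‖ₑ ^ (2 : ℝ) ≤ 2 * (‖f z‖ₑ ^ (2 : ℝ) + ‖g z‖ₑ ^ (2 : ℝ)) := by
    filter_upwards [ae_restrict_of_ae (AEEqFun.coeFn_add f g)] with z hz
    rw [hz, Pi.add_apply]
    calc ‖f z + g z‖ₑ ^ (2 : ℝ) ≤ (‖f z‖ₑ + ‖g z‖ₑ) ^ (2 : ℝ) := by
          gcongr
          exact enorm_add_le _ _
      _ ≤ _ := by
          have := ENNReal.rpow_add_le_mul_rpow_add_rpow ‖f z‖ₑ ‖g z‖ₑ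
            (by norm_num : (1 : ℝ) ≤ 2)
          norm_num at this ⊢
          exact this
  refine (lintegral_mono_ae h).trans ?_
  rw [lintegral_const_mul' _ _ ENNReal.ofNat_ne_top, lintegral_add_left']
  · rfl
  · exact (f.aestronglyMeasurable.restrict.enorm).pow_const _

theorem energy_neg (A : Set ℍ) (f : ℍ →ₘ[volume] ℂ) : energy A (-f) = energy A f := by
  refine lintegral_congr_ae (ae_restrict_of_ae ?_)
  filter_upwards [AEEqFun.coeFn_neg f] with z hz
  rw [hz, Pi.neg_apply, enorm_neg]

theorem energy_sub_le (A : Set ℍ) (f g : ℍ →ₘ[volume] ℂ) :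
    energy A (f - g) ≤ 2 * (energy A f + energy A g) := by
  rw [sub_eq_add_neg, ← energy_neg A g]
  exact energy_add_le A f (-g)

theorem energy_eq_zero_iff (A : Set ℍ) (f : ℍ →ₘ[volume] ℂ) :
    energy A f = 0 ↔ f =ᵐ[volume.restrict A] 0 := by
  rw [energy, lintegral_eq_zero_iff' ((f.aestronglyMeasurable.restrict.enorm).pow_const _)]
  refine Filter.eventually_congr (Filter.Eventually.of_forall fun z => ?_)
  simp

/-- If `f` is invariant under a group `P`, the translates of `A` by `P` are essentially disjoint,
and those of `B` cover `A`, then the energy of `f` on `A` is at most that on `B`. -/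
theorem energy_le_of_subset_iUnion {P : Type*} [Group P] [Countable P] (φ : P →* PSL(2, ℤ))
    {A B : Set ℍ} {f : ℍ →ₘ[volume] ℂ} (hf : ∀ p, translation (φ p) f = f)
    (hA : MeasurableSet A) (hdisj : ∀ p ≠ 1, AEDisjoint volume A (φ p • A))
    (hB : MeasurableSet B) (hsub : A ⊆ ⋃ p, φ p • B) : energy A f ≤ energy B f := by
  have hmeas : ∀ p, NullMeasurableSet ((φ p)⁻¹ • A ∩ B) volume := fun p =>
    ((hA.const_smul _).inter hB).nullMeasurableSet
  -- Cut `A` along the sets `p B` and move each piece back into `B` by invariance. The pieces `p⁻¹ A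
  -- ∩ B` overlap only in null sets; the sets `p B` themselves may overlap.
  calc energy A f ≤ energy (⋃ p, A ∩ φ p • B) f := energy_mono (fun z hz => by
          rw [← Set.inter_iUnion]
          exact ⟨hz, hsub hz⟩) f
    _ ≤ ∑' p, energy (A ∩ φ p • B) f := energy_iUnion_le _ _
    _ = ∑' p, energy ((φ p)⁻¹ • A ∩ B) f := by
        congr 1
        ext p
        conv_lhs => rw [← hf p]
        rw [energy_translation, Set.smul_set_inter, inv_smul_smul]
    _ = energy (⋃ p, (φ p)⁻¹ • A ∩ B) f := by
        refine (lintegral_iUnion₀ hmeas ?_ _).symm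
        intro p p' hpp
        refine AEDisjoint.mono ?_ Set.inter_subset_left Set.inter_subset_left
        have h1 := hdisj (p * p'⁻¹) (by rwa [Ne, mul_inv_eq_one])
        change volume ((φ p)⁻¹ • A ∩ (φ p')⁻¹ • A) = 0
        rw [← measure_smul volume (φ p), Set.smul_set_inter, smul_inv_smul, smul_smul, ← map_inv,
          ← map_mul]
        exact h1
    _ ≤ energy B f := energy_mono (Set.iUnion_subset fun p => Set.inter_subset_right) f

end Energy

/-! ### Estimates for the square integrals of elements of `F_q` -/

section Forms

variable {Γ : Subgroup PSL(2, ℤ)}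

theorem mem_formsF_zero_iff (f : ℍ →ₘ[volume] ℂ) :
    f ∈ formsF Γ 0 ↔ ∀ γ : Γ, translation (γ : PSL(2, ℤ)) f = f :=
  mem_higherInvariants_zero_iff _ _ _

/-- For `q = 0` the energy is the same on all fundamental domains. -/
theorem energy_eq_of_mem_formsF_zero {D D' : Set ℍ} (h : IsTameDomain Γ D) (h' : IsTameDomain Γ D')
    {f : ℍ →ₘ[volume] ℂ} (hf : f ∈ formsF Γ 0) : energy D f = energy D' f := by
  have key : ∀ {D D' : Set ℍ}, IsTameDomain Γ D → IsTameDomain Γ D' → energy D f ≤ energy D' f := by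
    intro D D' h h'
    refine energy_le_of_subset_iUnion Γ.subtype ((mem_formsF_zero_iff f).mp hf)
      h.isClosed.measurableSet (fun p hp => h.aedisjoint hp) h'.isClosed.measurableSet ?_
    exact (Set.subset_univ _).trans h'.covers.symm.subset
  exact le_antisymm (key h h') (key h' h)

theorem DomainChoice.tile_eq_biUnion (c : DomainChoice Γ) (q : ℕ) :
    c.tile q = ⋃ γ ∈ c.S ^ q, γ • c.D :=
  (Set.iUnion_smul_set (c.S ^ q) c.D).symm

theorem DomainChoice.finite_pow (c : DomainChoice Γ) (q : ℕ) : (c.S ^ q).Finite := by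
  induction q with
  | zero => simp
  | succ q ih =>
    rw [pow_succ]
    exact ih.mul c.finite

theorem DomainChoice.tile_mono (c : DomainChoice Γ) : Monotone c.tile :=
  fun _ _ hpq => Set.smul_subset_smul_right (Set.pow_subset_pow_right c.one_mem hpq)

theorem DomainChoice.tile_zero (c : DomainChoice Γ) : c.tile 0 = c.D := by
  simp [DomainChoice.tile]

theorem DomainChoice.smul_tile_subset (c : DomainChoice Γ) {s : Γ} (hs : s ∈ c.S) (q : ℕ) :
    s • c.tile q ⊆ c.tile (q + 1) := by
  rw [DomainChoice.tile, DomainChoice.tile, pow_succ', mul_smul]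
  exact Set.smul_set_subset_smul hs

/-- Splitting `s⁻¹ f = (s⁻¹ f - f) + f` on `D` isolates a difference whose order is lower. -/
theorem energy_smul_le_of_sub {D : Set ℍ} (f : ℍ →ₘ[volume] ℂ) (s : Γ) :
    energy (s • D) f ≤ 2 * (energy D (translation ((s⁻¹ : Γ) : PSL(2, ℤ)) f - f) + energy D f) := by
  have := energy_add_le D (translation ((s⁻¹ : Γ) : PSL(2, ℤ)) f - f) f
  rw [sub_add_cancel, energy_translation, Subgroup.coe_inv, inv_inv] at this
  exact this

theorem ae_eq_zero_of_energy_smul {D : Set ℍ} (h : IsTameDomain Γ D) {f : ℍ →ₘ[volume] ℂ}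
    (hf : ∀ γ : Γ, energy (γ • D) f = 0) : f = 0 := by
  have h0 : energy Set.univ f = 0 := by
    rw [← h.covers, ← nonpos_iff_eq_zero]
    refine (energy_iUnion_le _ f).trans ?_
    simp [hf]
  rw [energy_eq_zero_iff, Measure.restrict_univ] at h0
  exact AEEqFun.ext (h0.trans AEEqFun.coeFn_zero.symm)

theorem IsTameDomain.measurableSet_biUnion {D : Set ℍ} (h : IsTameDomain Γ D) (F : Set Γ) :
    MeasurableSet (⋃ γ ∈ F, γ • D) :=
  MeasurableSet.biUnion F.to_countable fun γ _ =>
    (h.isClosed.smul (γ : PSL(2, ℤ))).measurableSet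

variable [Γ.Normal]

theorem mem_formsF_succ_iff (q : ℕ) (f : ℍ →ₘ[volume] ℂ) :
    f ∈ formsF Γ (q + 1) ↔ (∀ γ : Γ, translation (γ : PSL(2, ℤ)) f - f ∈ formsF Γ q) ∧
      ∀ p ∈ parSubgroup Γ, translation (p : PSL(2, ℤ)) f = f :=
  mem_higherInvariants_succ_iff _ _ _ _

theorem formsF_mono : Monotone (formsF Γ) := higherInvariants_mono _ _

theorem translation_eq_of_mem_parSubgroup {q : ℕ} {f : ℍ →ₘ[volume] ℂ} (hf : f ∈ formsF Γ q)
    {p : Γ} (hp : p ∈ parSubgroup Γ) : translation (p : PSL(2, ℤ)) f = f :=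
  ((mem_formsF_succ_iff q f).mp (formsF_mono q.le_succ hf)).2 p hp

theorem translation_translation_conj (g : PSL(2, ℤ)) (γ : Γ) (f : ℍ →ₘ[volume] ℂ) :
    translation (γ : PSL(2, ℤ)) (translation g f) =
      translation g (translation ((MulAut.conjNormal g⁻¹ γ : Γ) : PSL(2, ℤ)) f) := by
  rw [← Module.End.mul_apply, ← Module.End.mul_apply, ← map_mul, ← map_mul,
    MulAut.conjNormal_apply]
  congr 2
  group

theorem translation_mem_formsF {q : ℕ} (g : PSL(2, ℤ)) {f : ℍ →ₘ[volume] ℂ}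
    (hf : f ∈ formsF Γ q) : translation g f ∈ formsF Γ q := by
  induction q generalizing f with
  | zero =>
    rw [mem_formsF_zero_iff] at hf ⊢
    intro γ
    rw [translation_translation_conj, hf]
  | succ q ih =>
    rw [mem_formsF_succ_iff] at hf ⊢
    refine ⟨fun γ => ?_, fun p hp => ?_⟩
    · rw [translation_translation_conj, ← map_sub]
      exact ih (hf.1 _)
    · rw [translation_translation_conj, hf.2 _ (conj_mem_parSubgroup _ hp)]

/-- The energy of `f ∈ F_q` on all translates of `D` is controlled by that on `S ^ q D`. -/
theorem DomainChoice.exists_energy_smul_le (c : DomainChoice Γ) (q : ℕ) (γ : Γ) :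
    ∃ C : ℝ≥0, ∀ f ∈ formsF Γ q, energy (γ • c.D) f ≤ C * energy (c.tile q) f := by
  induction q generalizing γ with
  | zero =>
    refine ⟨1, fun f hf => ?_⟩
    rw [c.tile_zero, ENNReal.coe_one, one_mul]
    exact (energy_eq_of_mem_formsF_zero (c.isDomain.isTameDomain.smul γ)
      c.isDomain.isTameDomain hf).le
  | succ q ih =>
    have hγ : γ ∈ Subgroup.closure c.S := c.generates ▸ Subgroup.mem_top γ
    have step : ∀ s ∈ c.S, ∀ γ : Γ,
        (∃ C : ℝ≥0, ∀ f ∈ formsF Γ (q + 1), energy (γ • c.D) f ≤ C * energy (c.tile (q + 1)) f) →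
        ∃ C : ℝ≥0, ∀ f ∈ formsF Γ (q + 1),
          energy ((s * γ) • c.D) f ≤ C * energy (c.tile (q + 1)) f := by
      rintro s hs γ ⟨C, hC⟩
      obtain ⟨C', hC'⟩ := ih γ
      -- The function `s⁻¹ f - f` has order `q`, so the outer induction bounds it on `γ D` by its
      -- energy on `S^q D`. That is at most `2 (E + E)`, since `S^q D` and `s S^q D` both lie in
      -- `S^{q+1} D`. The term `C E` comes from `f` on `γ D`, the outer 2 from the splitting.
      refine ⟨2 * (C' * 4 + C), fun f hf => ?_⟩
      have h1 := hC' _ (((mem_formsF_succ_iff q f).mp hf).1 s⁻¹)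
      have h2 := energy_sub_le (c.tile q) (translation ((s⁻¹ : Γ) : PSL(2, ℤ)) f) f
      have h3 : energy (c.tile q) (translation ((s⁻¹ : Γ) : PSL(2, ℤ)) f) ≤
          energy (c.tile (q + 1)) f := by
        rw [energy_translation]
        refine energy_mono ?_ f
        rw [Subgroup.coe_inv, inv_inv]
        exact c.smul_tile_subset hs q
      have h4 : energy (c.tile q) f ≤ energy (c.tile (q + 1)) f :=
        energy_mono (c.tile_mono q.le_succ) f
      set E := energy (c.tile (q + 1)) f with hE
      rw [mul_smul]
      calc energy (s • γ • c.D) f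
          ≤ 2 * (energy (γ • c.D) (translation ((s⁻¹ : Γ) : PSL(2, ℤ)) f - f) +
              energy (γ • c.D) f) := energy_smul_le_of_sub f s
        _ ≤ 2 * (C' * (2 * (E + E)) + C * E) := by
            gcongr
            · refine h1.trans ?_
              gcongr
              refine h2.trans ?_
              gcongr
            · exact hC f hf
        _ = _ := by
            push_cast
            ring
    induction hγ using Subgroup.closure_induction_left with
    | one =>
      refine ⟨1, fun f _ => ?_⟩
      rw [one_smul, ENNReal.coe_one, one_mul, ← c.tile_zero]
      exact energy_mono (c.tile_mono (Nat.zero_le _)) f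
    | mul_left s hs γ _ h => exact step s hs γ h
    | inv_mul_cancel s hs γ _ h => exact step s⁻¹ (c.symm s hs) γ h

/-- Elements of `F_q` are determined by their restriction to `S ^ q D`. -/
theorem DomainChoice.eq_of_ae_eq_tile (c : DomainChoice Γ) {q : ℕ} {f g : ℍ →ₘ[volume] ℂ}
    (hf : f ∈ formsF Γ q) (hg : g ∈ formsF Γ q) (hfg : f =ᵐ[volume.restrict (c.tile q)] g) :
    f = g := by
  rw [← sub_eq_zero]
  refine ae_eq_zero_of_energy_smul c.isDomain.isTameDomain fun γ => ?_
  obtain ⟨C, hC⟩ := c.exists_energy_smul_le q γ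
  have h0 : energy (c.tile q) (f - g) = 0 := by
    rw [energy_eq_zero_iff]
    filter_upwards [hfg, ae_restrict_of_ae (AEEqFun.coeFn_sub f g)] with z h1 h2
    rw [h2, Pi.sub_apply, h1, sub_self, Pi.zero_apply]
  have := hC _ (sub_mem hf hg)
  rwa [h0, mul_zero, nonpos_iff_eq_zero] at this

theorem energy_le_of_parSubgroup {A B : Set ℍ} {q : ℕ} {f : ℍ →ₘ[volume] ℂ} (hf : f ∈ formsF Γ q)
    (hA : MeasurableSet A) (hdisj : ∀ p ∈ parSubgroup Γ, p ≠ 1 → AEDisjoint volume A (p • A))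
    (hB : MeasurableSet B) (hsub : A ⊆ ⋃ p : parSubgroup Γ, p • B) : energy A f ≤ energy B f :=
  energy_le_of_subset_iUnion (Γ.subtype.comp (parSubgroup Γ).subtype)
    (fun p => translation_eq_of_mem_parSubgroup hf p.2) hA
    (fun p hp => hdisj p p.2 (by simpa using hp)) hB hsub

theorem DomainChoice.exists_energy_biUnion_le (c : DomainChoice Γ) (q : ℕ) {F : Set Γ}
    (hF : F.Finite) : ∃ C : ℝ≥0, ∀ f ∈ formsF Γ q,
      energy (⋃ γ ∈ F, γ • c.D) f ≤ C * energy (c.tile q) f := by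
  choose C hC using c.exists_energy_smul_le q
  lift F to Finset Γ using hF
  refine ⟨∑ γ ∈ F, C γ, fun f hf => (energy_biUnion_le F _ f).trans ?_⟩
  push_cast
  rw [Finset.sum_mul]
  exact Finset.sum_le_sum fun γ _ => hC γ f hf

variable [Γ.FiniteIndex]

/-- The energy of `f ∈ F_q` on any fundamental domain is controlled by that on `S ^ q D`. -/
theorem DomainChoice.exists_energy_le (c : DomainChoice Γ) (q : ℕ) {D : Set ℍ}
    (h : IsTameDomain Γ D) :
    ∃ C : ℝ≥0, ∀ f ∈ formsF Γ q, energy D f ≤ C * energy (c.tile q) f := by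
  obtain ⟨F, hF, hsub⟩ := c.isDomain.isTameDomain.subset_iUnion_smul h
  obtain ⟨C, hC⟩ := c.exists_energy_biUnion_le q hF
  exact ⟨C, fun f hf => (energy_le_of_parSubgroup hf h.isClosed.measurableSet
    (fun p _ hp => h.aedisjoint hp) (c.isDomain.isTameDomain.measurableSet_biUnion F) hsub).trans
      (hC f hf)⟩

/-- The set is a finite union of fundamental domains `g γ D'`. The case `g = 1` gives independence
of the topology, the case `c' = c` continuity of the action. -/
theorem DomainChoice.exists_energy_smul_tile_le (c c' : DomainChoice Γ) (q : ℕ)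
    (g : PSL(2, ℤ)) :
    ∃ C : ℝ≥0, ∀ f ∈ formsF Γ q, energy (g • c'.tile q) f ≤ C * energy (c.tile q) f := by
  choose C hC using fun γ : Γ => c.exists_energy_le q ((c'.isDomain.isTameDomain.smul γ).smul g)
  have hfin := c'.finite_pow q
  rw [c'.tile_eq_biUnion]
  refine ⟨∑ γ ∈ hfin.toFinset, C γ, fun f hf => ?_⟩
  have e : g • ⋃ γ ∈ c'.S ^ q, γ • c'.D = ⋃ γ ∈ hfin.toFinset, g • γ • c'.D := by
    simp only [Set.smul_set_iUnion, Set.Finite.mem_toFinset]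
  rw [e]
  refine (energy_biUnion_le _ _ f).trans ?_
  push_cast
  rw [Finset.sum_mul]
  exact Finset.sum_le_sum fun γ _ => hC γ f hf

end Forms

/-! ### Square integrability on the Borel-Serre space -/

section BorelSerre

/-- The part of the horoball at `∞` over `[-R, R]`. -/
def strip (R : ℝ) : Set ℍ := {z | |z.re| ≤ R ∧ 1 < z.im}

variable (Γ : Subgroup PSL(2, ℤ))

theorem continuous_borelSerre_inner : Continuous (BorelSerre.inner : ℍ → BorelSerre Γ) :=
  ⟨fun _ hU => hU.1⟩

variable {Γ}

theorem isCusp_of_isCusp_liftGL {c : OnePoint ℝ} (hc : IsCusp c (liftGL Γ)) :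
    ∃ h : SL(2, ℤ), c = Matrix.SpecialLinearGroup.mapGL ℝ h • OnePoint.infty := by
  refine isCusp_SL2Z_iff'.mp (hc.mono ?_)
  rintro _ ⟨g, -, rfl⟩
  exact ⟨g, rfl⟩

theorem isCusp_liftGL [Γ.Normal] [Γ.FiniteIndex] (h : SL(2, ℤ)) :
    IsCusp (Matrix.SpecialLinearGroup.mapGL ℝ h • OnePoint.infty) (liftGL Γ) := by
  have hN : (Γ.index : ℤ) ≠ 0 := by exact_mod_cast Subgroup.FiniteIndex.index_ne_zero
  refine ⟨_, ⟨h * ModularGroup.T ^ (Γ.index : ℤ) * h⁻¹, ?_, rfl⟩, mapGL_T_pow_isParabolic hN h, ?_⟩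
  · have := conj_pslT_index_mem (Γ := Γ) h 1
    rw [mul_one] at this
    exact this
  · rw [map_mul, map_mul, map_inv, mul_smul, mul_smul, inv_smul_smul]
    congr 1
    rw [OnePoint.smul_infty_eq_self_iff, mapGL_apply_eq_intCast, ModularGroup.coe_T_zpow]
    simp

/-- Neighbourhoods at a cusp `c` are tested with every real `g` such that `g ∞ = c`. Two such `g`
differ by some `b` fixing `∞`, which acts by `z ↦ a² z + a b₀₁` with `a` its upper left entry. -/
theorem SL2R_smul_of_lower_left_zero {b : SL(2, ℝ)} (hb : b 1 0 = 0) (z : ℍ) :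
    (b • z).re = b 0 0 ^ 2 * z.re + b 0 0 * b 0 1 ∧ (b • z).im = b 0 0 ^ 2 * z.im := by
  have hdet := Matrix.det_fin_two (b : Matrix (Fin 2) (Fin 2) ℝ)
  rw [b.det_coe, hb, mul_zero, sub_zero] at hdet
  have ha : b 0 0 ≠ 0 := fun h => by simp [h] at hdet
  have hd : b 1 1 = (b 0 0)⁻¹ := eq_inv_of_mul_eq_one_right hdet.symm
  have hcoe : ((b • z : ℍ) : ℂ) = (b 0 0 : ℂ) ^ 2 * z + b 0 0 * b 0 1 := by
    have ha' : (b 0 0 : ℂ) ≠ 0 := by exact_mod_cast ha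
    rw [UpperHalfPlane.coe_specialLinearGroup_apply, hb, hd]
    simp
    field_simp
  have hcast : (b 0 0 : ℂ) ^ 2 * z + b 0 0 * b 0 1 =
      ((b 0 0 ^ 2 : ℝ) : ℂ) * z + ((b 0 0 * b 0 1 : ℝ) : ℂ) := by
    push_cast
    ring
  rw [hcast] at hcoe
  constructor
  · rw [← UpperHalfPlane.coe_re, hcoe, Complex.add_re, Complex.re_ofReal_mul, Complex.ofReal_re,
      UpperHalfPlane.coe_re]
  · rw [← UpperHalfPlane.coe_im, hcoe, Complex.add_im, Complex.im_ofReal_mul, Complex.ofReal_im,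
      UpperHalfPlane.coe_im, add_zero]

theorem SL2R_smul_coe_of_lower_left_zero {b : SL(2, ℝ)} (hb : b 1 0 = 0) (x : ℝ) :
    (b : GL (Fin 2) ℝ) • (x : OnePoint ℝ) =
      ((b 0 0 ^ 2 * x + b 0 0 * b 0 1 : ℝ) : OnePoint ℝ) := by
  have hdet := Matrix.det_fin_two (b : Matrix (Fin 2) (Fin 2) ℝ)
  rw [b.det_coe, hb, mul_zero, sub_zero] at hdet
  have ha : b 0 0 ≠ 0 := fun h => by simp [h] at hdet
  have hd : b 1 1 = (b 0 0)⁻¹ := eq_inv_of_mul_eq_one_right hdet.symm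
  rw [OnePoint.smul_some_eq_ite]
  simp only [Matrix.SpecialLinearGroup.coe_GL_coe_matrix, hb, hd, zero_mul, zero_add,
    inv_eq_zero, ha, if_false]
  congr 1
  field_simp

theorem isCompact_rectangle (R a b : ℝ) (ha : 0 < a) :
    IsCompact {z : ℍ | |z.re| ≤ R ∧ a ≤ z.im ∧ z.im ≤ b} := by
  rw [UpperHalfPlane.isEmbedding_coe.isCompact_iff]
  convert (isCompact_Icc (a := -R) (b := R)).reProdIm (isCompact_Icc (a := a) (b := b)) using 1
  ext w
  constructor
  · rintro ⟨z, ⟨h1, h2⟩, rfl⟩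
    exact ⟨abs_le.mp h1, h2⟩
  · rintro ⟨h1, h2⟩
    exact ⟨⟨w, ha.trans_le h2.1⟩, ⟨abs_le.mpr h1, h2⟩, rfl⟩

theorem energy_union_lt_top {A B : Set ℍ} {f : ℍ →ₘ[volume] ℂ} (hA : energy A f < ∞)
    (hB : energy B f < ∞) : energy (A ∪ B) f < ∞ :=
  (energy_union_le A B f).trans_lt (ENNReal.add_lt_top.mpr ⟨hA, hB⟩)

theorem energy_lt_top_of_mem_L2loc {f : ℍ →ₘ[volume] ℂ} (hf : f ∈ L2loc Γ) {K : Set ℍ}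
    (hK : IsCompact K) : energy K f < ∞ := by
  refine hK.induction_on (p := fun s => energy s f < ∞) (by simp [energy])
    (fun s t hst ht => (energy_mono hst f).trans_lt ht) (fun s t hs ht => energy_union_lt_top hs ht)
    fun z _ => ?_
  obtain ⟨U, hU, hfU⟩ := hf (BorelSerre.inner z)
  exact ⟨_, mem_nhdsWithin_of_mem_nhds ((continuous_borelSerre_inner Γ).continuousAt hU),
    (memLp_two_restrict_iff _ f).mp hfU⟩

/-- By compactness of `[-R, R]` in the boundary line, finitely many neighbourhoods of boundary
points cover the strip above some height. What remains is contained in a compact rectangle. -/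
theorem energy_strip_lt_top_of_mem_L2loc [Γ.Normal] [Γ.FiniteIndex] {f : ℍ →ₘ[volume] ℂ}
    (hf : f ∈ L2loc Γ) (g : PSL(2, ℤ)) (R : ℝ) : energy (g • strip R) f < ∞ := by
  induction g using QuotientGroup.induction_on with
  | H h =>
    have key : ∃ Y : ℝ, energy ((h : PSL(2, ℤ)) • {z : ℍ | z.re ∈ Set.Icc (-R) R ∧ Y < z.im}) f <
        ∞ := by
      refine (isCompact_Icc (a := -R) (b := R)).induction_on
        (p := fun s => ∃ Y : ℝ, energy ((h : PSL(2, ℤ)) • {z : ℍ | z.re ∈ s ∧ Y < z.im}) f < ∞)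
        ?_ ?_ ?_ ?_
      · exact ⟨0, by simp [energy]⟩
      · rintro s t hst ⟨Y, hY⟩
        refine ⟨Y, (energy_mono (Set.smul_set_mono ?_) f).trans_lt hY⟩
        exact fun z hz => ⟨hst hz.1, hz.2⟩
      · rintro s t ⟨Y, hY⟩ ⟨Y', hY'⟩
        refine ⟨max Y Y', (energy_mono ?_ f).trans_lt (energy_union_lt_top hY hY')⟩
        rw [← Set.smul_set_union]
        refine Set.smul_set_mono fun z hz => ?_
        have hz2 := max_lt_iff.mp hz.2
        exact hz.1.imp (fun h => ⟨h, hz2.1⟩) (fun h => ⟨h, hz2.2⟩)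
      · intro x _
        let g : SL(2, ℝ) := Matrix.SpecialLinearGroup.map (Int.castRingHom ℝ) h
        have hx : (g : GL (Fin 2) ℝ) • (x : OnePoint ℝ) ≠
            (g : GL (Fin 2) ℝ) • OnePoint.infty := by
          rw [Ne, smul_left_cancel_iff]
          exact OnePoint.coe_ne_infty x
        obtain ⟨U, hU, hfU⟩ := hf (BorelSerre.bdry _ _ (isCusp_liftGL h) hx)
        obtain ⟨V, hVU, hV, hxV⟩ := mem_nhds_iff.mp hU
        obtain ⟨ε, hε, hε1, -⟩ := hV.2 g x _ _ _ hx rfl rfl hxV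
        refine ⟨_, mem_nhdsWithin_of_mem_nhds (Metric.ball_mem_nhds x hε), 1 / ε, ?_⟩
        refine (energy_mono ?_ f).trans_lt ((memLp_two_restrict_iff _ f).mp hfU)
        rintro _ ⟨z, ⟨hz1, hz2⟩, rfl⟩
        exact hVU (hε1 z hz1 hz2)
    obtain ⟨Y, hY⟩ := key
    have hK : IsCompact ((h : PSL(2, ℤ)) • {z : ℍ | |z.re| ≤ R ∧ 1 ≤ z.im ∧ z.im ≤ Y}) :=
      (isCompact_rectangle R 1 Y one_pos).smul (h : PSL(2, ℤ))
    refine (energy_mono ?_ f).trans_lt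
      (energy_union_lt_top hY (energy_lt_top_of_mem_L2loc hf hK))
    rw [← Set.smul_set_union]
    refine Set.smul_set_mono fun z hz => ?_
    rcases lt_or_ge Y z.im with hz2 | hz2
    · exact Or.inl ⟨abs_le.mp hz.1, hz2⟩
    · exact Or.inr ⟨hz.1, hz.2.le, hz2⟩

/-- A neighbourhood of boundary points of `ℍ_Γ`. -/
def cuspNhd (Γ : Subgroup PSL(2, ℤ)) (g : SL(2, ℝ)) (I : Set ℝ) : Set (BorelSerre Γ) :=
  {b | match b with
    | .inner z => (g⁻¹ • z).re ∈ I ∧ 1 < (g⁻¹ • z).im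
    | .bdry c p _ _ => c = (g : GL (Fin 2) ℝ) • OnePoint.infty ∧
        ∃ x ∈ I, p = (g : GL (Fin 2) ℝ) • ((x : ℝ) : OnePoint ℝ)}

theorem isOpen_cuspNhd (g : SL(2, ℝ)) {I : Set ℝ} (hI : IsOpen I) : IsOpen (cuspNhd Γ g I) := by
  constructor
  · have hc : Continuous fun z : ℍ => g⁻¹ • z := continuous_const_smul g⁻¹
    exact (hI.preimage (UpperHalfPlane.continuous_re.comp hc)).inter
      (isOpen_lt continuous_const (UpperHalfPlane.continuous_im.comp hc))
  · rintro g' x c p hc hp rfl rfl ⟨h1, x', hx', h2⟩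
    obtain ⟨b, rfl⟩ : ∃ b, g' = g * b := ⟨g⁻¹ * g', by simp⟩
    rw [map_mul, mul_smul, smul_left_cancel_iff, OnePoint.smul_infty_eq_self_iff] at h1
    have hb : b 1 0 = 0 := h1
    rw [map_mul, mul_smul, smul_left_cancel_iff, SL2R_smul_coe_of_lower_left_zero hb,
      OnePoint.coe_eq_coe] at h2
    have ha : 0 < b 0 0 ^ 2 := by
      have hdet := Matrix.det_fin_two (b : Matrix (Fin 2) (Fin 2) ℝ)
      rw [b.det_coe, hb, mul_zero, sub_zero] at hdet
      have : b 0 0 ≠ 0 := fun h => by simp [h] at hdet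
      positivity
    obtain ⟨δ, hδ, hδI⟩ := Metric.isOpen_iff.mp hI x' hx'
    -- Write `a = b 0 0`. The bound `δ / a²` keeps the foot in `I`, as feet are stretched by `a²`;
    -- the bound `a²` turns `Im z > 1/ε` into `a² Im z > 1`.
    have key : ∀ y : ℝ, |y - x| < min (δ / b 0 0 ^ 2) (b 0 0 ^ 2) →
        b 0 0 ^ 2 * y + b 0 0 * b 0 1 ∈ I := fun y hy => by
      apply hδI
      rw [Metric.mem_ball, Real.dist_eq, ← h2,
        show b 0 0 ^ 2 * y + b 0 0 * b 0 1 - (b 0 0 ^ 2 * x + b 0 0 * b 0 1) =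
          b 0 0 ^ 2 * (y - x) by ring, abs_mul, abs_of_pos ha, mul_comm, ← lt_div_iff₀ ha]
      exact hy.trans_le (min_le_left _ _)
    refine ⟨min (δ / b 0 0 ^ 2) (b 0 0 ^ 2), lt_min (div_pos hδ ha) ha, fun z hz1 hz2 => ?_,
      fun y p' hp' hy hp'' => ?_⟩
    · change (g⁻¹ • (g * b) • z).re ∈ I ∧ 1 < (g⁻¹ • (g * b) • z).im
      rw [mul_smul, inv_smul_smul, (SL2R_smul_of_lower_left_zero hb z).1,
        (SL2R_smul_of_lower_left_zero hb z).2]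
      refine ⟨key _ hz1, ?_⟩
      have h3 := (one_div_le_one_div_of_le (lt_min (div_pos hδ ha) ha)
        (min_le_right (δ / b 0 0 ^ 2) (b 0 0 ^ 2))).trans_lt hz2
      rwa [div_lt_iff₀ ha, mul_comm] at h3
    · refine ⟨?_, _, key y hy, ?_⟩
      · rw [map_mul, mul_smul, OnePoint.smul_infty_eq_self_iff.mpr h1]
      · rw [hp'', map_mul, mul_smul, SL2R_smul_coe_of_lower_left_zero hb]

/-- Neighbourhoods of boundary points may be taken narrow. Width 1 makes the strips disjoint from
their translates (`disjoint_smul_narrow_strip`), as unfolding requires. -/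
theorem mem_L2loc_of_energy_lt_top {f : ℍ →ₘ[volume] ℂ}
    (h1 : ∀ K : Set ℍ, IsCompact K → energy K f < ∞)
    (h2 : ∀ (g : PSL(2, ℤ)) (x : ℝ),
      energy (g • {z : ℍ | |z.re - x| < 1 / 2 ∧ 1 < z.im}) f < ∞) : f ∈ L2loc Γ := by
  rintro (z | ⟨c, p, hc, hp⟩)
  · obtain ⟨K, hK, hzK⟩ := exists_compact_mem_nhds z
    -- The condition at the boundary is vacuous for a set without boundary points.
    refine ⟨BorelSerre.inner '' interior K, IsOpen.mem_nhds ⟨?_, ?_⟩ ?_, ?_⟩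
    · rw [Set.preimage_image_eq _ fun _ _ h => BorelSerre.inner.inj h]
      exact isOpen_interior
    · rintro _ _ _ _ _ _ _ _ ⟨z, -, hz⟩
      cases hz
    · exact ⟨z, mem_interior_iff_mem_nhds.mpr hzK, rfl⟩
    · rw [Set.preimage_image_eq _ fun _ _ h => BorelSerre.inner.inj h, memLp_two_restrict_iff]
      exact (energy_mono interior_subset f).trans_lt (h1 K hK)
  · obtain ⟨h, rfl⟩ := isCusp_of_isCusp_liftGL hc
    let g : SL(2, ℝ) := Matrix.SpecialLinearGroup.map (Int.castRingHom ℝ) h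
    obtain ⟨x, hx⟩ : ∃ x : ℝ, (x : OnePoint ℝ) = (g : GL (Fin 2) ℝ)⁻¹ • p := by
      refine OnePoint.ne_infty_iff_exists.mp fun hinf => hp ?_
      rw [inv_smul_eq_iff] at hinf
      exact hinf
    refine ⟨cuspNhd Γ g (Metric.ball x (1 / 2)), (isOpen_cuspNhd g Metric.isOpen_ball).mem_nhds
      ⟨rfl, x, Metric.mem_ball_self (by norm_num), by rw [hx, smul_inv_smul]⟩, ?_⟩
    rw [memLp_two_restrict_iff]
    refine (energy_mono ?_ f).trans_lt (h2 h x)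
    rintro z ⟨hz1, hz2⟩
    rw [Set.mem_smul_set_iff_inv_smul_mem]
    have e : (h : PSL(2, ℤ))⁻¹ • z = g⁻¹ • z := by
      rw [inv_smul_eq_iff]
      change z = g • g⁻¹ • z
      rw [smul_inv_smul]
    rw [e]
    exact ⟨hz1, hz2⟩

/-! ### Square integrability on fundamental domains against local square integrability -/

variable [Γ.Normal] [Γ.FiniteIndex]

/-- In this form the space is visibly stable under `Γ(1)`. -/
theorem mem_L2loc_iff (f : ℍ →ₘ[volume] ℂ) :
    f ∈ L2loc Γ ↔ (∀ K : Set ℍ, IsCompact K → energy K f < ∞) ∧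
      ∀ (g : PSL(2, ℤ)) (R : ℝ), energy (g • strip R) f < ∞ := by
  refine ⟨fun hf => ⟨fun K hK => energy_lt_top_of_mem_L2loc hf hK,
    energy_strip_lt_top_of_mem_L2loc hf⟩, fun ⟨h1, h2⟩ => mem_L2loc_of_energy_lt_top h1 ?_⟩
  intro g x
  refine (energy_mono (Set.smul_set_mono ?_) f).trans_lt (h2 g (|x| + 1 / 2))
  rintro z ⟨hz1, hz2⟩
  refine ⟨?_, hz2⟩
  have := abs_add_le (z.re - x) x
  rw [sub_add_cancel] at this
  linarith

theorem translation_mem_L2q {q : ℕ} (g : PSL(2, ℤ)) {f : ℍ →ₘ[volume] ℂ} (hf : f ∈ L2q Γ q) :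
    translation g f ∈ L2q Γ q := by
  refine ⟨?_, translation_mem_formsF g hf.2⟩
  obtain ⟨h1, h2⟩ := (mem_L2loc_iff f).mp hf.1
  refine (mem_L2loc_iff _).mpr ⟨fun K hK => ?_, fun g' R => ?_⟩
  · rw [energy_translation]
    exact h1 _ (hK.smul g⁻¹)
  · rw [energy_translation, smul_smul]
    exact h2 _ R

theorem measurableSet_strip (R : ℝ) : MeasurableSet (strip R) :=
  (measurableSet_le (UpperHalfPlane.continuous_re.abs.measurable) measurable_const).inter
    isOpen_horoball.measurableSet

theorem IsTameDomain.energy_lt_top {D : Set ℍ} (h : IsTameDomain Γ D) {q : ℕ}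
    {f : ℍ →ₘ[volume] ℂ} (hf : f ∈ L2q Γ q) : energy D f < ∞ := by
  obtain ⟨F₁, F₂, hF₁, hF₂, hsub⟩ := h.subset_iUnion_parSubgroup
  refine (energy_le_of_parSubgroup hf.2 h.isClosed.measurableSet
    (fun p _ hp => h.aedisjoint hp) (MeasurableSet.union ?_ ?_) hsub).trans_lt
      (energy_union_lt_top ?_ ?_)
  · exact MeasurableSet.biUnion hF₁.countable fun g _ =>
      ((ModularGroup.isCompact_truncatedFundamentalDomain 1).smul g).measurableSet
  · exact MeasurableSet.biUnion hF₂.countable fun g _ => (measurableSet_strip _).const_smul g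
  · exact energy_lt_top_of_mem_L2loc hf.1 (hF₁.isCompact_biUnion fun g _ =>
      (ModularGroup.isCompact_truncatedFundamentalDomain 1).smul g)
  · lift F₂ to Finset PSL(2, ℤ) using hF₂
    refine (energy_biUnion_le F₂ _ f).trans_lt (ENNReal.sum_lt_top.mpr fun g _ => ?_)
    exact energy_strip_lt_top_of_mem_L2loc hf.1 g _

/-- An element taking a point of the strip into the strip is conjugate by `g` to some `T ^ k`, and
`|k| < 1` by comparison of real parts. -/
theorem disjoint_smul_narrow_strip (g : PSL(2, ℤ)) (x : ℝ) {γ : PSL(2, ℤ)} (hγ : γ ≠ 1) :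
    Disjoint (g • {z : ℍ | |z.re - x| < 1 / 2 ∧ 1 < z.im})
      (γ • g • {z : ℍ | |z.re - x| < 1 / 2 ∧ 1 < z.im}) := by
  rw [Set.disjoint_left]
  rintro _ ⟨z, hz, rfl⟩ ⟨_, ⟨w, hw, rfl⟩, he⟩
  have he' : (g⁻¹ * γ * g) • w = z := by
    rw [mul_smul, mul_smul, inv_smul_eq_iff]
    exact he
  obtain ⟨k, hk⟩ := eq_pslT_zpow_of_mem_horoball (γ := g⁻¹ * γ * g) (z := w) hw.2 (he' ▸ hz.2)
  rw [hk] at he'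
  have h1 := re_pslT_zpow_smul k w
  rw [he'] at h1
  have h2 := abs_lt.mp hz.1
  have h3 := abs_lt.mp hw.1
  have h4 : (k : ℝ) < 1 := by linarith
  have h5 : (-1 : ℝ) < k := by linarith
  have hk0 : k = 0 := by
    have h4' : k < 1 := by exact_mod_cast h4
    have h5' : -1 < k := by exact_mod_cast h5
    omega
  apply hγ
  rw [hk0, zpow_zero, mul_assoc, inv_mul_eq_iff_eq_mul, mul_one] at hk
  exact mul_eq_right.mp hk

/-- Compact sets are covered by finitely many `γ D`, and narrow strips are too up to `Γ_par`;
conversely `S^q D` is a finite union of domains, each covered up to `Γ_par` by compact sets and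
strips. -/
theorem DomainChoice.mem_L2q_iff (c : DomainChoice Γ) {q : ℕ} {f : ℍ →ₘ[volume] ℂ}
    (hf : f ∈ formsF Γ q) : energy (c.tile q) f < ∞ ↔ f ∈ L2q Γ q := by
  have hD := c.isDomain.isTameDomain
  constructor
  · intro h
    have hbi : ∀ F : Set Γ, F.Finite → energy (⋃ γ ∈ F, γ • c.D) f < ∞ := fun F hF => by
      obtain ⟨C, hC⟩ := c.exists_energy_biUnion_le q hF
      exact (hC f hf).trans_lt (ENNReal.mul_lt_top ENNReal.coe_lt_top h)
    refine ⟨mem_L2loc_of_energy_lt_top (fun K hK => ?_) (fun g x => ?_), hf⟩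
    · obtain ⟨F, hF, hsub⟩ := hD.isCompact_subset hK
      exact (energy_mono hsub f).trans_lt (hbi F hF)
    · obtain ⟨F, hF, hsub⟩ := hD.smul_horoball_subset g
      refine (energy_le_of_parSubgroup hf ?_ (fun p _ hp => ?_) (hD.measurableSet_biUnion F)
        ((Set.smul_set_mono ?_).trans hsub)).trans_lt (hbi F hF)
      · refine MeasurableSet.const_smul (MeasurableSet.inter ?_ isOpen_horoball.measurableSet) g
        exact measurableSet_lt
          ((UpperHalfPlane.continuous_re.sub continuous_const).abs.measurable) measurable_const
      · exact (disjoint_smul_narrow_strip g x (by simpa using hp)).aedisjoint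
      · exact fun z hz => hz.2
  · intro h
    have hfin := c.finite_pow q
    have e : c.tile q = ⋃ γ ∈ hfin.toFinset, γ • c.D := by
      rw [c.tile_eq_biUnion]
      simp only [Set.Finite.mem_toFinset]
    rw [e]
    refine (energy_biUnion_le _ _ f).trans_lt (ENNReal.sum_lt_top.mpr fun γ _ => ?_)
    exact (hD.smul (γ : PSL(2, ℤ))).energy_lt_top h

end BorelSerre

/-! ### The constant function -/

section ConstantFunction

theorem volume_upperHalfPlane_ne_zero : (volume : Measure ℍ) ≠ 0 := by
  intro h
  have h1 : (volume : Measure ℍ) Set.univ = 0 := by simp [h]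
  have hopen : IsOpen (UpperHalfPlane.coe '' Set.univ : Set ℂ) :=
    UpperHalfPlane.isOpenEmbedding_coe.isOpenMap _ isOpen_univ
  have hmeas : Measurable fun z : ℂ => (((1 / ‖z.im‖₊) ^ 2 : ℝ≥0) : ℝ≥0∞) := by fun_prop
  rw [UpperHalfPlane.volume_eq_lintegral, setLIntegral_eq_zero_iff hopen.measurableSet hmeas] at h1
  have h2 : volume (UpperHalfPlane.coe '' Set.univ : Set ℂ) = 0 := by
    refine measure_mono_null ?_ h1
    rintro _ ⟨z, -, rfl⟩ hz
    have := hz ⟨z, trivial, rfl⟩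
    simp [z.im_ne_zero] at this
  exact (hopen.measure_pos volume ⟨_, UpperHalfPlane.I, trivial, rfl⟩).ne' h2

/-- The area is at most `2R ∫₁^∞ dy/y²`. -/
theorem volume_strip_lt_top (R : ℝ) : volume (strip R) < ∞ := by
  have hmeas : Measurable fun y : ℝ => (((1 / ‖y‖₊) ^ 2 : ℝ≥0) : ℝ≥0∞) := by fun_prop
  have h1 : ∫⁻ y in Set.Ioi (1 : ℝ), (((1 / ‖y‖₊) ^ 2 : ℝ≥0) : ℝ≥0∞) < ∞ := by
    have h2 := (integrableOn_Ioi_rpow_of_lt (by norm_num : (-2 : ℝ) < -1) one_pos).2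
    refine lt_of_eq_of_lt (setLIntegral_congr_fun measurableSet_Ioi fun y hy => ?_) h2
    have hy0 : (0 : ℝ) < y := one_pos.trans hy
    rw [enorm_eq_nnnorm]
    congr 1
    ext
    simp [Real.rpow_neg hy0.le, abs_of_pos hy0]
  rw [UpperHalfPlane.volume_eq_lintegral]
  calc ∫⁻ z : ℂ in UpperHalfPlane.coe '' strip R, (((1 / ‖z.im‖₊) ^ 2 : ℝ≥0) : ℝ≥0∞)
      ≤ ∫⁻ z : ℂ in Complex.measurableEquivRealProd ⁻¹' (Set.Icc (-R) R ×ˢ Set.Ioi 1),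
          (((1 / ‖(Complex.measurableEquivRealProd z).2‖₊) ^ 2 : ℝ≥0) : ℝ≥0∞) := by
        refine lintegral_mono_set ?_
        rintro _ ⟨z, hz, rfl⟩
        exact ⟨abs_le.mp hz.1, hz.2⟩
    _ = ∫⁻ p in Set.Icc (-R) R ×ˢ Set.Ioi (1 : ℝ), (((1 / ‖p.2‖₊) ^ 2 : ℝ≥0) : ℝ≥0∞) :=
        Complex.volume_preserving_equiv_real_prod.setLIntegral_comp_preimage_emb
          Complex.measurableEquivRealProd.measurableEmbedding
          (fun p : ℝ × ℝ => (((1 / ‖p.2‖₊) ^ 2 : ℝ≥0) : ℝ≥0∞)) _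
    _ = volume (Set.Icc (-R) R) *
          ∫⁻ y in Set.Ioi (1 : ℝ), (((1 / ‖y‖₊) ^ 2 : ℝ≥0) : ℝ≥0∞) := by
        rw [Measure.volume_eq_prod, ← Measure.prod_restrict]
        have := lintegral_prod_mul (μ := volume.restrict (Set.Icc (-R) R))
          (ν := volume.restrict (Set.Ioi (1 : ℝ))) (f := fun _ => 1)
          (g := fun y : ℝ => (((1 / ‖y‖₊) ^ 2 : ℝ≥0) : ℝ≥0∞))
          aemeasurable_const hmeas.aemeasurable
        simpa using this
    _ < ∞ := ENNReal.mul_lt_top (by simp) h1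

/-- The constant function `1`. -/
noncomputable def oneForm : ℍ →ₘ[volume] ℂ := AEEqFun.const ℍ 1

theorem oneForm_ne_zero : oneForm ≠ 0 := by
  intro h
  have h1 : (fun _ => 1 : ℍ → ℂ) =ᵐ[volume] fun _ => 0 :=
    
    (AEEqFun.coeFn_const ℍ (1 : ℂ)).symm.trans (by
      change oneForm =ᵐ[volume] _
      rw [h]
      exact AEEqFun.coeFn_zero)
  refine volume_upperHalfPlane_ne_zero (ae_eq_bot.mp (Filter.eventually_false_iff_eq_bot.mp ?_))
  filter_upwards [h1] with z hz
  exact one_ne_zero hz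

theorem energy_oneForm (A : Set ℍ) : energy A oneForm = volume A := by
  have : energy A oneForm = ∫⁻ _ in A, 1 := by
    refine lintegral_congr_ae (ae_restrict_of_ae ?_)
    filter_upwards [AEEqFun.coeFn_const ℍ (1 : ℂ)] with z hz
    rw [oneForm, hz]
    simp
  rw [this, setLIntegral_one]

variable {Γ : Subgroup PSL(2, ℤ)}

theorem oneForm_mem_formsF_zero : oneForm ∈ formsF Γ 0 :=
  (mem_formsF_zero_iff _).mpr fun _ => rfl

variable [Γ.Normal] [Γ.FiniteIndex]

theorem oneForm_mem_L2q (q : ℕ) : oneForm ∈ L2q Γ q := by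
  refine ⟨(mem_L2loc_iff _).mpr ⟨fun K hK => ?_, fun g R => ?_⟩,
    formsF_mono (Nat.zero_le q) oneForm_mem_formsF_zero⟩
  · rw [energy_oneForm]
    exact hK.measure_lt_top
  · rw [energy_oneForm, measure_smul]
    exact volume_strip_lt_top R

end ConstantFunction

/-! ### Functions of order one attached to homomorphisms -/

section TileFunction

variable {Γ : Subgroup PSL(2, ℤ)} {D : Set ℍ}

theorem IsTameDomain.ae_mem_smul_interior (h : IsTameDomain Γ D) (γ : Γ) :
    ∀ᵐ z ∂volume, z ∈ γ • D → z ∈ γ • interior D := by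
  have h0 : volume ((γ : PSL(2, ℤ)) • frontier D) = 0 := by
    rw [measure_smul, h.frontier_null]
  filter_upwards [measure_eq_zero_iff_ae_notMem.mp h0] with z hz hzD
  by_contra hzi
  have hzD' : (γ : PSL(2, ℤ))⁻¹ • z ∈ D := Set.mem_smul_set_iff_inv_smul_mem.mp hzD
  exact hz (Set.mem_smul_set_iff_inv_smul_mem.mpr ⟨subset_closure hzD',
    fun hi => hzi (Set.mem_smul_set_iff_inv_smul_mem.mpr hi)⟩)

/-- The function assigning to `z ∈ γ D` the element `γ`. -/
theorem IsTameDomain.exists_index (h : IsTameDomain Γ D) : ∃ i : ℍ → Γ,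
    (∀ s : Set Γ, MeasurableSet (i ⁻¹' s)) ∧ ∀ γ : Γ, ∀ z ∈ γ • interior D, i z = γ := by
  classical
  -- The default value 1 is taken only off the translates of the interior, a null set.
  let i : ℍ → Γ := fun z => if hz : ∃ γ : Γ, z ∈ γ • interior D then hz.choose else 1
  have huniq : ∀ (γ γ' : Γ) (z : ℍ), z ∈ γ • interior D → z ∈ γ' • interior D → γ = γ' := by
    intro γ γ' z hz hz'
    by_contra hne
    have h1 := h.disjoint (γ⁻¹ * γ') (by rwa [Ne, inv_mul_eq_one])
    refine Set.disjoint_left.mp h1 (Set.mem_smul_set_iff_inv_smul_mem.mp hz) ?_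
    have e : interior ((γ⁻¹ * γ') • D) = (γ⁻¹ * γ') • interior D :=
      interior_smul ((γ⁻¹ * γ' : Γ) : PSL(2, ℤ)) D
    rw [e, mul_smul]
    exact Set.smul_mem_smul_set hz'
  have hi : ∀ γ : Γ, ∀ z ∈ γ • interior D, i z = γ := by
    intro γ z hz
    have hex : ∃ γ : Γ, z ∈ γ • interior D := ⟨γ, hz⟩
    simp only [i, dif_pos hex]
    exact huniq _ _ z hex.choose_spec hz
  have hmeas : ∀ γ : Γ, MeasurableSet (γ • interior D) := fun γ =>
    (isOpen_interior.smul (γ : PSL(2, ℤ))).measurableSet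
  refine ⟨i, fun s => ?_, hi⟩
  have e : i ⁻¹' s = (⋃ γ ∈ s, γ • interior D) ∪
      ((⋃ γ : Γ, γ • interior D)ᶜ ∩ {_z | (1 : Γ) ∈ s}) := by
    ext z
    by_cases hz : ∃ γ : Γ, z ∈ γ • interior D
    · obtain ⟨γ, hγ⟩ := hz
      simp only [Set.mem_preimage, hi γ z hγ, Set.mem_union, Set.mem_iUnion, Set.mem_inter_iff,
        Set.mem_compl_iff]
      constructor
      · exact fun hs => Or.inl ⟨γ, hs, hγ⟩
      · rintro (⟨γ', hs, hγ'⟩ | ⟨hn, -⟩)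
        · rwa [huniq γ γ' z hγ hγ']
        · exact absurd ⟨γ, hγ⟩ hn
    · have h1 : i z = 1 := dif_neg hz
      simp only [Set.mem_preimage, h1, Set.mem_union, Set.mem_iUnion, Set.mem_inter_iff,
        Set.mem_compl_iff]
      constructor
      · exact fun hs => Or.inr ⟨hz, hs⟩
      · rintro (⟨γ', hs, hγ'⟩ | ⟨-, hs⟩)
        · exact absurd ⟨γ', hγ'⟩ hz
        · exact hs
  rw [e]
  exact (MeasurableSet.biUnion s.to_countable fun γ _ => hmeas γ).union
    ((MeasurableSet.iUnion hmeas).compl.inter (MeasurableSet.const _))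

variable [Γ.Normal] [Γ.FiniteIndex]

/-- Take `f = χ(δ)` on `δ D`: then `(γ f)(z) = χ(γ⁻¹ δ) = χ(δ) - χ(γ)` there, in additive notation.
It is constant on each of the finitely many pieces of `S^q D`, which have finite area. -/
theorem DomainChoice.exists_translation_eq_sub (c : DomainChoice Γ) {q : ℕ} (hq : 1 ≤ q)
    (χ : Γ →* Multiplicative ℂ) (hχ : ∀ p ∈ parSubgroup Γ, χ p = 1) :
    ∃ f ∈ L2q Γ q, ∀ γ : Γ,
      translation (γ : PSL(2, ℤ)) f = f - Multiplicative.toAdd (χ γ) • oneForm := by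
  have hD := c.isDomain.isTameDomain
  obtain ⟨i, hi, hiD⟩ := hD.exists_index
  have hmeas : Measurable fun z => Multiplicative.toAdd (χ (i z)) :=
    fun s _ => hi {γ | Multiplicative.toAdd (χ γ) ∈ s}
  let f : ℍ →ₘ[volume] ℂ := AEEqFun.mk _ hmeas.aestronglyMeasurable
  have hf : ∀ᵐ z ∂volume, ∀ γ : Γ, z ∈ γ • c.D → f z = Multiplicative.toAdd (χ γ) := by
    filter_upwards [AEEqFun.coeFn_mk _ hmeas.aestronglyMeasurable,
      ae_all_iff.mpr hD.ae_mem_smul_interior] with z hz1 hz2 γ hγ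
    rw [hz1, hiD γ z (hz2 γ hγ)]
  have hone := AEEqFun.coeFn_const ℍ (1 : ℂ) (μ := volume)
  have htrans : ∀ γ : Γ,
      translation (γ : PSL(2, ℤ)) f = f - Multiplicative.toAdd (χ γ) • oneForm := by
    intro γ
    apply AEEqFun.ext
    filter_upwards [translation_ae (γ : PSL(2, ℤ)) f, hf,
      (measurePreserving_smul (γ : PSL(2, ℤ))⁻¹ volume).quasiMeasurePreserving.ae hf,
      AEEqFun.coeFn_sub f (Multiplicative.toAdd (χ γ) • oneForm),
      AEEqFun.coeFn_smul (Multiplicative.toAdd (χ γ)) oneForm, hone] with z h1 h2 h3 h4 h5 h6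
    obtain ⟨δ, hδ⟩ := hD.exists_mem_smul z
    have hδ' : (γ : PSL(2, ℤ))⁻¹ • z ∈ (γ⁻¹ * δ) • c.D := by
      rw [mul_smul]
      exact Set.smul_mem_smul_set (a := γ⁻¹) hδ
    rw [h1, h3 _ hδ', h4, Pi.sub_apply, h2 _ hδ, h5, Pi.smul_apply]
    change _ = _ - _ • (AEEqFun.const ℍ (1 : ℂ) : ℍ →ₘ[volume] ℂ) z
    rw [h6]
    simp
    ring
  have hf1 : f ∈ formsF Γ 1 := by
    rw [mem_formsF_succ_iff]
    refine ⟨fun γ => ?_, fun p hp => ?_⟩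
    · rw [htrans, sub_sub_cancel_left]
      exact neg_mem ((formsF Γ 0).smul_mem _ oneForm_mem_formsF_zero)
    · rw [htrans, hχ p hp]
      exact (congrArg (f - ·) (zero_smul ℂ oneForm)).trans (sub_zero f)
  have hfq : f ∈ formsF Γ q := formsF_mono hq hf1
  refine ⟨f, (c.mem_L2q_iff hfq).mp ?_, htrans⟩
  have hfin := c.finite_pow q
  have e : c.tile q = ⋃ γ ∈ hfin.toFinset, γ • c.D := by
    rw [c.tile_eq_biUnion]
    simp only [Set.Finite.mem_toFinset]
  rw [e]
  refine (energy_biUnion_le _ _ f).trans_lt (ENNReal.sum_lt_top.mpr fun γ _ => ?_)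
  have h1 : energy (γ • c.D) f = energy (γ • c.D) (Multiplicative.toAdd (χ γ) • oneForm) := by
    refine lintegral_congr_ae ?_
    have hm : MeasurableSet (γ • c.D) :=
      (hD.isClosed.smul (γ : PSL(2, ℤ))).measurableSet
    rw [Filter.EventuallyEq, ae_restrict_iff' hm]
    filter_upwards [hf, AEEqFun.coeFn_smul (Multiplicative.toAdd (χ γ)) oneForm, hone]
      with z h1 h2 h3 hz
    rw [h1 γ hz, h2, Pi.smul_apply]
    change _ = ‖_ • (AEEqFun.const ℍ (1 : ℂ) : ℍ →ₘ[volume] ℂ) z‖ₑ ^ _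
    rw [h3]
    simp
  rw [h1]
  exact (hD.smul (γ : PSL(2, ℤ))).energy_lt_top ((L2q Γ q).smul_mem _ (oneForm_mem_L2q q))

end TileFunction

/-! ### Limits -/

section Limits

open Filter

variable {Γ : Subgroup PSL(2, ℤ)}

theorem ae_tendsto_translation {f : ℕ → ℍ →ₘ[volume] ℂ} {g : ℍ →ₘ[volume] ℂ}
    (h : ∀ᵐ z ∂volume, Tendsto (fun n => f n z) atTop (𝓝 (g z))) (γ : PSL(2, ℤ)) :
    ∀ᵐ z ∂volume, Tendsto (fun n => translation γ (f n) z) atTop (𝓝 (translation γ g z)) := by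
  filter_upwards [(measurePreserving_smul γ⁻¹ volume).quasiMeasurePreserving.ae h,
    translation_ae γ g, ae_all_iff.mpr fun n => translation_ae γ (f n)] with z h1 h2 h3
  simpa only [h2, h3] using h1

theorem ae_tendsto_sub {f f' : ℕ → ℍ →ₘ[volume] ℂ} {g g' : ℍ →ₘ[volume] ℂ}
    (h : ∀ᵐ z ∂volume, Tendsto (fun n => f n z) atTop (𝓝 (g z)))
    (h' : ∀ᵐ z ∂volume, Tendsto (fun n => f' n z) atTop (𝓝 (g' z))) :
    ∀ᵐ z ∂volume, Tendsto (fun n => (f n - f' n) z) atTop (𝓝 ((g - g') z)) := by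
  filter_upwards [h, h', AEEqFun.coeFn_sub g g',
    ae_all_iff.mpr fun n => AEEqFun.coeFn_sub (f n) (f' n)] with z h1 h2 h3 h4
  simpa only [h3, h4, Pi.sub_apply] using h1.sub h2

theorem eq_of_ae_tendsto {f : ℕ → ℍ →ₘ[volume] ℂ} {g g' : ℍ →ₘ[volume] ℂ}
    (h : ∀ᵐ z ∂volume, Tendsto (fun n => f n z) atTop (𝓝 (g z)))
    (h' : ∀ᵐ z ∂volume, Tendsto (fun n => f n z) atTop (𝓝 (g' z))) : g = g' := by
  apply AEEqFun.ext
  filter_upwards [h, h'] with z h1 h2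
  exact tendsto_nhds_unique h1 h2

theorem translation_eq_of_ae_tendsto {f : ℕ → ℍ →ₘ[volume] ℂ} {g : ℍ →ₘ[volume] ℂ}
    (h : ∀ᵐ z ∂volume, Tendsto (fun n => f n z) atTop (𝓝 (g z))) {γ : PSL(2, ℤ)}
    (hf : ∀ n, translation γ (f n) = f n) : translation γ g = g := by
  have := ae_tendsto_translation h γ
  simp_rw [hf] at this
  exact eq_of_ae_tendsto this h

theorem DomainChoice.measurableSet_tile (c : DomainChoice Γ) (q : ℕ) :
    MeasurableSet (c.tile q) := by
  rw [c.tile_eq_biUnion]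
  exact c.isDomain.isTameDomain.measurableSet_biUnion _

theorem ae_smul_of_ae {p : ℍ → Prop} (hp : ∀ᵐ z ∂volume, p z) (γ : Γ) : ∀ᵐ z ∂volume, p (γ • z) :=
  (measurePreserving_smul (γ : PSL(2, ℤ)) volume).quasiMeasurePreserving.ae hp

theorem DomainChoice.ae_of_tile (c : DomainChoice Γ) (q : ℕ) {p : ℍ → Prop}
    (h : ∀ᵐ z ∂volume, z ∈ c.tile q → p z) (hγ : ∀ γ : Γ, ∀ᵐ z ∂volume, p (γ • z) → p z) :
    ∀ᵐ z ∂volume, p z := by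
  filter_upwards [ae_all_iff.mpr hγ, ae_all_iff.mpr (ae_smul_of_ae (Γ := Γ) h)] with z h1 h2
  obtain ⟨γ, hz⟩ := c.isDomain.isTameDomain.exists_mem_smul z
  refine h1 γ⁻¹ (h2 γ⁻¹ (c.tile_mono (Nat.zero_le q) ?_))
  rw [c.tile_zero]
  exact Set.mem_smul_set_iff_inv_smul_mem.mp hz

variable [Γ.Normal]

/-- The recursion involves only translations and differences, and both commute with a.e. limits. -/
theorem mem_formsF_of_ae_tendsto {q : ℕ} {f : ℕ → ℍ →ₘ[volume] ℂ} {g : ℍ →ₘ[volume] ℂ}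
    (hf : ∀ n, f n ∈ formsF Γ q)
    (h : ∀ᵐ z ∂volume, Tendsto (fun n => f n z) atTop (𝓝 (g z))) : g ∈ formsF Γ q := by
  induction q generalizing f g with
  | zero =>
    simp_rw [mem_formsF_zero_iff] at hf ⊢
    exact fun γ => translation_eq_of_ae_tendsto h fun n => hf n γ
  | succ q ih =>
    simp_rw [mem_formsF_succ_iff] at hf ⊢
    exact ⟨fun γ => ih (fun n => (hf n).1 γ) (ae_tendsto_sub (ae_tendsto_translation h _) h),
      fun p hp => translation_eq_of_ae_tendsto h fun n => (hf n).2 p hp⟩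

/-- Pointwise convergence on `S ^ q D` of elements of `F_q` implies pointwise convergence. -/
theorem DomainChoice.ae_tendsto_of_tile (c : DomainChoice Γ) {q : ℕ} {f : ℕ → ℍ →ₘ[volume] ℂ}
    (hf : ∀ n, f n ∈ formsF Γ q)
    (h : ∀ᵐ z ∂volume, z ∈ c.tile q → ∃ l, Tendsto (fun n => f n z) atTop (𝓝 l)) :
    ∀ᵐ z ∂volume, ∃ l, Tendsto (fun n => f n z) atTop (𝓝 l) := by
  induction q generalizing f with
  | zero =>
    refine c.ae_of_tile _ h fun γ => ?_
    filter_upwards [ae_all_iff.mpr fun n => translation_ae ((γ⁻¹ : Γ) : PSL(2, ℤ)) (f n)]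
      with z hz ⟨l, hl⟩
    refine ⟨l, ?_⟩
    convert hl using 2 with n
    have := hz n
    rw [(mem_formsF_zero_iff _).mp (hf n), Subgroup.coe_inv, inv_inv] at this
    exact this
  | succ q ih =>
    refine c.ae_of_tile _ h fun γ => ?_
    have step : ∀ s ∈ c.S, ∀ᵐ z ∂volume, (∃ l, Tendsto (fun n => f n (s • z)) atTop (𝓝 l)) →
        ∃ l, Tendsto (fun n => f n z) atTop (𝓝 l) := by
      intro s hs
      -- The `g n` have order `q` and converge on `S^q D`, hence a.e. by induction. As `f n z = f n
      -- (s z) - g n z`, convergence at `s z` passes to `z`.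
      let g : ℕ → ℍ →ₘ[volume] ℂ := fun n => translation ((s⁻¹ : Γ) : PSL(2, ℤ)) (f n) - f n
      have hg : ∀ᵐ z ∂volume, ∀ n, g n z = f n (s • z) - f n z := by
        rw [ae_all_iff]
        intro n
        filter_upwards [translation_ae ((s⁻¹ : Γ) : PSL(2, ℤ)) (f n),
          AEEqFun.coeFn_sub (translation ((s⁻¹ : Γ) : PSL(2, ℤ)) (f n)) (f n)] with z h1 h2
        rw [h2, Pi.sub_apply, h1, Subgroup.coe_inv, inv_inv]
        rfl
      have hgF : ∀ n, g n ∈ formsF Γ q := fun n => ((mem_formsF_succ_iff q (f n)).mp (hf n)).1 s⁻¹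
      have hgc : ∀ᵐ z ∂volume, z ∈ c.tile q → ∃ l, Tendsto (fun n => g n z) atTop (𝓝 l) := by
        filter_upwards [hg, h, ae_smul_of_ae h s] with z h1 h2 h3 hz
        obtain ⟨l, hl⟩ := h2 (c.tile_mono q.le_succ hz)
        obtain ⟨l', hl'⟩ := h3 (c.smul_tile_subset hs q (Set.smul_mem_smul_set hz))
        exact ⟨l' - l, by simpa only [h1] using hl'.sub hl⟩
      have hall := ih hgF hgc
      filter_upwards [hall, hg] with z ⟨l, hl⟩ h2 ⟨l', hl'⟩
      refine ⟨l' - l, ?_⟩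
      convert hl'.sub hl using 2 with n
      rw [h2, sub_sub_cancel]
    have hγ : γ ∈ Subgroup.closure c.S := c.generates ▸ Subgroup.mem_top γ
    have step' : ∀ s ∈ c.S, ∀ γ : Γ,
        (∀ᵐ z ∂volume, (∃ l, Tendsto (fun n => f n (γ • z)) atTop (𝓝 l)) →
          ∃ l, Tendsto (fun n => f n z) atTop (𝓝 l)) →
        ∀ᵐ z ∂volume, (∃ l, Tendsto (fun n => f n ((s * γ) • z)) atTop (𝓝 l)) →
          ∃ l, Tendsto (fun n => f n z) atTop (𝓝 l) := by
      intro s hs γ hγ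
      filter_upwards [hγ, ae_smul_of_ae (step s hs) γ] with z h1 h2 h3
      simp only [mul_smul] at h3
      exact h1 (h2 h3)
    induction hγ using Subgroup.closure_induction_left with
    | one => simp
    | mul_left s hs γ _ h => exact step' s hs γ h
    | inv_mul_cancel s hs γ _ h => exact step' s⁻¹ (c.symm s hs) γ h

end Limits

/-! ### The restriction maps -/

section Restriction

variable {Γ : Subgroup PSL(2, ℤ)} [Γ.Normal]

theorem DomainChoice.energy_smul_tile (c : DomainChoice Γ) (q : ℕ) (g : PSL(2, ℤ))
    (f : ℍ →ₘ[volume] ℂ) :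
    energy (g • c.tile q) f = ∑' γ : (c.S ^ q : Set Γ), energy (g • (γ : Γ) • c.D) f := by
  have hD := c.isDomain.isTameDomain
  rw [c.tile_eq_biUnion, Set.biUnion_eq_iUnion, Set.smul_set_iUnion]
  refine lintegral_iUnion₀ (fun γ => ?_) (fun γ γ' hne => ?_) _
  · exact ((hD.smul ((γ : Γ) : PSL(2, ℤ))).nullMeasurableSet_smul g)
  · change volume (g • (γ : Γ) • c.D ∩ g • (γ' : Γ) • c.D) = 0
    rw [← Set.smul_set_inter, measure_smul]
    exact hD.isFundamentalDomain.aedisjoint (Subtype.coe_ne_coe.mpr hne)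

variable [Γ.FiniteIndex]

theorem DomainChoice.memLp_tile (c : DomainChoice Γ) {q : ℕ} (f : L2q Γ q) :
    MemLp (f : ℍ →ₘ[volume] ℂ) 2 (volume.restrict (c.tile q)) :=
  (memLp_two_restrict_iff _ _).mpr ((c.mem_L2q_iff f.2.2).mpr f.2)

/-- The restriction of elements of `L²_q(Γ \ ℍ)` to `S ^ q D`. -/
noncomputable def DomainChoice.restriction (c : DomainChoice Γ) (q : ℕ) :
    L2q Γ q →ₗ[ℂ] Lp ℂ 2 (volume.restrict (c.tile q)) where
  toFun f := (c.memLp_tile f).toLp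
  map_add' f g := by
    rw [← MemLp.toLp_add (c.memLp_tile f) (c.memLp_tile g)]
    exact MemLp.toLp_congr _ _ (ae_restrict_of_ae (AEEqFun.coeFn_add _ _))
  map_smul' a f := by
    rw [RingHom.id_apply, ← MemLp.toLp_const_smul a (c.memLp_tile f)]
    exact MemLp.toLp_congr _ _ (ae_restrict_of_ae (AEEqFun.coeFn_smul _ _))

theorem DomainChoice.restriction_sub (c : DomainChoice Γ) {q : ℕ} (f g : L2q Γ q) :
    c.restriction q (f - g) = c.restriction q f - c.restriction q g :=
  eq_sub_of_add_eq (((c.restriction q).map_add (f - g) g).symm.trans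
    (congrArg (c.restriction q) (sub_add_cancel f g)))

theorem DomainChoice.restriction_ae_eq (c : DomainChoice Γ) {q : ℕ} (f : L2q Γ q) :
    c.restriction q f =ᵐ[volume.restrict (c.tile q)] (f : ℍ →ₘ[volume] ℂ) :=
  MemLp.coeFn_toLp (c.memLp_tile f)

theorem DomainChoice.enorm_restriction_sq (c : DomainChoice Γ) {q : ℕ} (f : L2q Γ q) :
    ‖c.restriction q f‖ₑ ^ 2 = energy (c.tile q) f := by
  rw [← eLpNorm_two_restrict, Lp.enorm_def]
  congr 1
  exact eLpNorm_congr_ae (c.restriction_ae_eq f)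

theorem DomainChoice.restriction_injective (c : DomainChoice Γ) (q : ℕ) :
    Function.Injective (c.restriction q) := by
  intro f g hfg
  refine Subtype.ext (c.eq_of_ae_eq_tile f.2.2 g.2.2 ?_)
  have := c.restriction_ae_eq g
  rw [← hfg] at this
  exact (c.restriction_ae_eq f).symm.trans this

-- A subsequence converges a.e. on `S^q D`, hence a.e. on `ℍ`. Its limit lies in `F_q` and restricts
-- to the given `L²` limit, so it is square integrable on `S^q D`.
open Filter in
theorem DomainChoice.isClosed_range_restriction (c : DomainChoice Γ) (q : ℕ) :
    IsClosed (Set.range (c.restriction q)) := by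
  refine IsSeqClosed.isClosed fun x u hx hu => ?_
  choose f hf using hx
  obtain ⟨ns, -, hns⟩ := (tendstoInMeasure_of_tendsto_Lp hu).exists_seq_tendsto_ae
  have h1 : ∀ᵐ z ∂(volume.restrict (c.tile q)),
      Tendsto (fun n => (f (ns n) : ℍ →ₘ[volume] ℂ) z) atTop (𝓝 (u z)) := by
    filter_upwards [hns, ae_all_iff.mpr fun n => c.restriction_ae_eq (f (ns n))] with z hz hz'
    simp_rw [← hf, hz'] at hz
    exact hz
  have h2 := c.ae_tendsto_of_tile (fun n => (f (ns n)).2.2)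
    ((ae_restrict_iff' (c.measurableSet_tile q)).mp (h1.mono fun z hz => ⟨_, hz⟩))
  obtain ⟨F, hF, hFlim⟩ := exists_stronglyMeasurable_limit_of_tendsto_ae
    (fun n => (f (ns n) : ℍ →ₘ[volume] ℂ).aestronglyMeasurable) h2
  let G : ℍ →ₘ[volume] ℂ := AEEqFun.mk F hF.aestronglyMeasurable
  have hG : ∀ᵐ z ∂volume, Tendsto (fun n => (f (ns n) : ℍ →ₘ[volume] ℂ) z) atTop (𝓝 (G z)) := by
    filter_upwards [hFlim, AEEqFun.coeFn_mk F hF.aestronglyMeasurable] with z hz hz'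
    rwa [hz']
  have hGF : G ∈ formsF Γ q := mem_formsF_of_ae_tendsto (fun n => (f (ns n)).2.2) hG
  have hGu : G =ᵐ[volume.restrict (c.tile q)] u := by
    filter_upwards [ae_restrict_of_ae hG, h1] with z hz hz'
    exact tendsto_nhds_unique hz hz'
  have hG2 : G ∈ L2q Γ q := by
    rw [← c.mem_L2q_iff hGF, ← memLp_two_restrict_iff, memLp_congr_ae hGu]
    exact Lp.memLp u
  refine ⟨⟨G, hG2⟩, Lp.ext ((c.restriction_ae_eq _).trans hGu)⟩

/-! ### Independence of the topology and continuity of the action -/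

theorem norm_le_of_enorm_sq_le {E F : Type*} [SeminormedAddCommGroup E] [SeminormedAddCommGroup F]
    {x : E} {y : F} {C : ℝ≥0} (h : ‖x‖ₑ ^ 2 ≤ C * ‖y‖ₑ ^ 2) : ‖x‖ ≤ NNReal.sqrt C * ‖y‖ := by
  have h1 : ‖x‖₊ ^ 2 ≤ C * ‖y‖₊ ^ 2 := by
    rw [enorm_eq_nnnorm, enorm_eq_nnnorm] at h
    exact_mod_cast h
  have h2 : ‖x‖₊ ≤ NNReal.sqrt C * ‖y‖₊ := by
    rw [← NNReal.sqrt_sq ‖y‖₊, ← NNReal.sqrt_mul, ← NNReal.sqrt_sq ‖x‖₊]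
    exact NNReal.sqrt_le_sqrt.mpr h1
  exact NNReal.coe_le_coe.mpr h2

theorem induced_le_induced_of_dist_le {V E F : Type*} [PseudoMetricSpace E] [PseudoMetricSpace F]
    (A : V → E) (B : V → F) (C : ℝ≥0) (h : ∀ v w, dist (B v) (B w) ≤ C * dist (A v) (A w)) :
    TopologicalSpace.induced A inferInstance ≤ TopologicalSpace.induced B inferInstance := by
  let := PseudoMetricSpace.induced A ‹_›
  exact continuous_iff_le_induced.mp (LipschitzWith.of_dist_le_mul (K := C) h).continuous

/-- The action of `Γ(1)` on `L²_q(Γ \ ℍ)`. -/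
noncomputable def L2qAction (Γ : Subgroup PSL(2, ℤ)) [Γ.Normal] [Γ.FiniteIndex] (q : ℕ) :
    Representation ℂ PSL(2, ℤ) (L2q Γ q) where
  toFun g := (translation g).restrict fun _ hf => translation_mem_L2q g hf
  map_one' := by
    ext1 f
    exact Subtype.ext (by simp)
  map_mul' g h := by
    ext1 f
    exact Subtype.ext (by simp)

theorem coe_L2qAction (q : ℕ) (g : PSL(2, ℤ)) (f : L2q Γ q) :
    (L2qAction Γ q g f : ℍ →ₘ[volume] ℂ) = translation g f := rfl

theorem L2qAction_sub (q : ℕ) (g : PSL(2, ℤ)) (f f' : L2q Γ q) :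
    L2qAction Γ q g (f - f') = L2qAction Γ q g f - L2qAction Γ q g f' :=
  Subtype.ext (map_sub (translation g) (f : ℍ →ₘ[volume] ℂ) f')

theorem DomainChoice.exists_dist_restriction_le (c c' : DomainChoice Γ) (q : ℕ) (g : PSL(2, ℤ)) :
    ∃ C : ℝ≥0, ∀ f f', dist (c'.restriction q (L2qAction Γ q g f))
      (c'.restriction q (L2qAction Γ q g f')) ≤ C * dist (c.restriction q f) (c.restriction q f') := by
  obtain ⟨C, hC⟩ := c.exists_energy_smul_tile_le c' q g⁻¹
  refine ⟨NNReal.sqrt C, fun f f' => ?_⟩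
  rw [dist_eq_norm, dist_eq_norm, ← c.restriction_sub, ← c'.restriction_sub, ← L2qAction_sub]
  refine norm_le_of_enorm_sq_le ?_
  rw [c'.enorm_restriction_sq, c.enorm_restriction_sq, coe_L2qAction, energy_translation]
  exact hC _ (f - f').2.2

theorem DomainChoice.induced_restriction_le (c c' : DomainChoice Γ) (q : ℕ) :
    TopologicalSpace.induced (c.restriction q) inferInstance ≤
      TopologicalSpace.induced (c'.restriction q) inferInstance := by
  obtain ⟨C, hC⟩ := c.exists_dist_restriction_le c' q 1
  simp only [map_one, Module.End.one_apply] at hC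
  exact induced_le_induced_of_dist_le _ _ C hC

theorem DomainChoice.continuous_L2qAction (c : DomainChoice Γ) (q : ℕ) (g : PSL(2, ℤ)) :
    Continuous[TopologicalSpace.induced (c.restriction q) inferInstance,
      TopologicalSpace.induced (c.restriction q) inferInstance] (L2qAction Γ q g) := by
  obtain ⟨C, hC⟩ := c.exists_dist_restriction_le c q g
  rw [continuous_iff_le_induced, induced_compose]
  exact induced_le_induced_of_dist_le _ _ C hC

/-! ### Dependence of the inner product on the choices, and unitarity -/

theorem infinite_of_finiteIndex : Infinite Γ := by
  refine Infinite.of_injective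
    (fun k : ℤ => (⟨_, conj_pslT_index_mem (Γ := Γ) 1 k⟩ : Γ)) fun k l hkl => ?_
  have h1 : (1 : PSL(2, ℤ)) * pslT ^ ((Γ.index : ℤ) * k) * 1⁻¹ =
      1 * pslT ^ ((Γ.index : ℤ) * l) * 1⁻¹ := congrArg Subtype.val hkl
  rw [inv_one, one_mul, mul_one, one_mul, mul_one] at h1
  have h2 := re_pslT_zpow_smul ((Γ.index : ℤ) * k) UpperHalfPlane.I
  rw [h1, re_pslT_zpow_smul, add_right_inj] at h2
  have h3 : (Γ.index : ℤ) * l = Γ.index * k := by exact_mod_cast h2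
  exact (mul_left_cancel₀ (by exact_mod_cast Subgroup.FiniteIndex.index_ne_zero) h3).symm

/-- Adjoining `s` and `s⁻¹` to the set of generators. -/
def DomainChoice.adjoin (c : DomainChoice Γ) (s : Γ) : DomainChoice Γ where
  S := c.S ∪ {s, s⁻¹}
  finite := c.finite.union (Set.toFinite _)
  one_mem := Or.inl c.one_mem
  symm t ht := by
    rcases ht with ht | rfl | rfl
    · exact Or.inl (c.symm t ht)
    · exact Or.inr (Or.inr rfl)
    · exact Or.inr (Or.inl (inv_inv s))
  generates := top_le_iff.mp (c.generates ▸ Subgroup.closure_mono Set.subset_union_left)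
  D := c.D
  isDomain := c.isDomain

theorem inner_restriction_self (c : DomainChoice Γ) {q : ℕ} (f : L2q Γ q) :
    inner ℂ (c.restriction q f) (c.restriction q f) =
      ((energy (c.tile q) f).toReal : ℂ) := by
  rw [inner_self_eq_norm_sq_to_K, ← c.enorm_restriction_sq, ENNReal.toReal_pow, toReal_enorm]
  simp

/-- As `Γ` is infinite, some `s` lies outside the finite set `S^q`. Adjoining it enlarges the tile
by at least `s D`, which raises the norm of the constant `1`. -/
theorem DomainChoice.exists_inner_ne (c : DomainChoice Γ) {q : ℕ} (hq : 1 ≤ q) :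
    ∃ (c' : DomainChoice Γ) (f g : L2q Γ q),
      inner ℂ (c.restriction q f) (c.restriction q g) ≠
        inner ℂ (c'.restriction q f) (c'.restriction q g) := by
  have hD := c.isDomain.isTameDomain
  have := infinite_of_finiteIndex (Γ := Γ)
  obtain ⟨s, hs⟩ := (c.finite_pow q).exists_notMem
  let e : L2q Γ q := ⟨oneForm, oneForm_mem_L2q q⟩
  refine ⟨c.adjoin s, e, e, fun heq => ?_⟩
  rw [inner_restriction_self, inner_restriction_self] at heq
  have hfin : ∀ c : DomainChoice Γ, energy (c.tile q) oneForm < ∞ := fun c =>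
    (c.mem_L2q_iff e.2.2).mpr e.2
  have heq' : energy (c.tile q) oneForm = energy ((c.adjoin s).tile q) oneForm :=
    (ENNReal.toReal_eq_toReal_iff' (hfin _).ne (hfin _).ne).mp (by exact_mod_cast heq)
  have hdisj : AEDisjoint volume (c.tile q) (s • c.D) := by
    rw [c.tile_eq_biUnion]
    refine (AEDisjoint.iUnion_left_iff.mpr fun γ => AEDisjoint.iUnion_left_iff.mpr fun hγ => ?_)
    exact hD.isFundamentalDomain.aedisjoint (show γ ≠ s from fun h => hs (h ▸ hγ))
  have hsub : c.tile q ∪ s • c.D ⊆ (c.adjoin s).tile q := by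
    refine Set.union_subset (Set.smul_subset_smul_right
      (Set.pow_subset_pow_left Set.subset_union_left)) ?_
    have hsmem : s ∈ (c.adjoin s).S ^ q :=
      Set.pow_subset_pow_right (c.adjoin s).one_mem hq (by
        rw [pow_one]
        exact Or.inr (Or.inl rfl))
    exact Set.smul_set_subset_smul (t := c.D) hsmem
  have hle : energy (c.tile q) oneForm + energy (s • c.D) oneForm ≤
      energy (c.tile q) oneForm := by
    conv_rhs => rw [heq']
    refine le_trans (le_of_eq ?_) (energy_mono hsub _)
    rw [energy_oneForm, energy_oneForm, energy_oneForm]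
    exact (measure_union₀ (hD.nullMeasurableSet_smul (s : PSL(2, ℤ))) hdisj).symm
  have h0 : energy (s • c.D) oneForm = 0 := by
    have := ENNReal.le_of_add_le_add_left (hfin c).ne (hle.trans_eq (add_zero _).symm)
    exact nonpos_iff_eq_zero.mp this
  -- If `s D` had area zero, so would every translate of `D`, and `1` would vanish a.e.
  refine oneForm_ne_zero (ae_eq_zero_of_energy_smul hD fun γ => ?_)
  rw [← h0]
  exact energy_eq_of_mem_formsF_zero (hD.smul (γ : PSL(2, ℤ))) (hD.smul (s : PSL(2, ℤ)))
    oneForm_mem_formsF_zero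

/-- Up to null sets, `S^q D` and its translate by `g⁻¹` are disjoint unions of equally many
fundamental domains, and an invariant function has the same energy on each. -/
theorem DomainChoice.norm_restriction_action (c : DomainChoice Γ) {q : ℕ} (g : PSL(2, ℤ))
    {f : L2q Γ q} (hf : (f : ℍ →ₘ[volume] ℂ) ∈ formsF Γ 0) :
    ‖c.restriction q (L2qAction Γ q g f)‖ = ‖c.restriction q f‖ := by
  have hD := c.isDomain.isTameDomain
  have h1 : ‖c.restriction q (L2qAction Γ q g f)‖ₑ ^ 2 = ‖c.restriction q f‖ₑ ^ 2 := by
    rw [c.enorm_restriction_sq, c.enorm_restriction_sq, coe_L2qAction, energy_translation,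
      c.energy_smul_tile]
    conv_rhs => rw [← one_smul PSL(2, ℤ) (c.tile q), c.energy_smul_tile]
    congr 1
    ext γ
    exact energy_eq_of_mem_formsF_zero ((hD.smul ((γ : Γ) : PSL(2, ℤ))).smul _)
      ((hD.smul ((γ : Γ) : PSL(2, ℤ))).smul _) hf
  have h2 := congrArg ENNReal.toReal h1
  rw [ENNReal.toReal_pow, ENNReal.toReal_pow, toReal_enorm, toReal_enorm] at h2
  exact (sq_eq_sq₀ (norm_nonneg _) (norm_nonneg _)).mp h2

theorem DomainChoice.inner_restriction_action (c : DomainChoice Γ) {q : ℕ}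
    (h : formsF Γ q ≤ formsF Γ 0) (g : PSL(2, ℤ)) (f f' : L2q Γ q) :
    inner ℂ (c.restriction q (L2qAction Γ q g f)) (c.restriction q (L2qAction Γ q g f')) =
      inner ℂ (c.restriction q f) (c.restriction q f') := by
  have hn : ∀ f : L2q Γ q, ‖c.restriction q (L2qAction Γ q g f)‖ = ‖c.restriction q f‖ :=
    fun f => c.norm_restriction_action g (h f.2.2)
  rw [inner_eq_sum_norm_sq_div_four, inner_eq_sum_norm_sq_div_four (c.restriction q f)]
  have hs : ∀ f f' : L2q Γ q, ‖c.restriction q (L2qAction Γ q g f - L2qAction Γ q g f')‖ =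
      ‖c.restriction q (f - f')‖ := fun f f' => by
    rw [← hn (f - f'), L2qAction_sub]
  simp only [← map_smul, ← map_add, ← c.restriction_sub, hn, hs]

/-- Since `γ 1 = 1` and `γ f = f - χ(γ) 1`, unitarity gives `⟨1, f⟩ = ⟨1, f⟩ - χ(γ) ‖1‖²`, so `χ(γ)
= 0`. Conversely, under either alternative `F_q = F_0`, where norms are preserved and polarization
applies. -/
theorem DomainChoice.unitary_iff (c : DomainChoice Γ) (q : ℕ) :
    (∀ (g : PSL(2, ℤ)) (f f' : L2q Γ q),
      inner ℂ (c.restriction q (L2qAction Γ q g f)) (c.restriction q (L2qAction Γ q g f')) =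
        inner ℂ (c.restriction q f) (c.restriction q f')) ↔
      q = 0 ∨ ∀ χ : Γ →* Multiplicative ℂ, (∀ p ∈ parSubgroup Γ, χ p = 1) → χ = 1 := by
  constructor
  · intro hu
    refine or_iff_not_imp_left.mpr fun hq χ hχ => ?_
    obtain ⟨f, hf, hfχ⟩ := c.exists_translation_eq_sub (Nat.one_le_iff_ne_zero.mpr hq) χ hχ
    let e : L2q Γ q := ⟨oneForm, oneForm_mem_L2q q⟩
    ext1 γ
    have h1 : L2qAction Γ q γ ⟨f, hf⟩ = ⟨f, hf⟩ - Multiplicative.toAdd (χ γ) • e :=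
      Subtype.ext (hfχ γ)
    have h2 : L2qAction Γ q γ e = e := rfl
    have h3 := hu γ e ⟨f, hf⟩
    rw [h1, h2, c.restriction_sub, map_smul, inner_sub_right, inner_smul_right, sub_eq_self,
      mul_eq_zero, inner_self_eq_zero] at h3
    rcases h3 with h3 | h3
    · exact h3
    · rw [← map_zero (c.restriction q)] at h3
      exact absurd (congrArg Subtype.val (c.restriction_injective q h3)) oneForm_ne_zero
  · intro h g f f'
    refine c.inner_restriction_action (le_of_eq ?_) g f f'
    rcases h with rfl | h
    · rfl
    · exact higherInvariants_eq_zero _ _ h q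

end Restriction

theorem mainTheorem6 (Γ : Subgroup PSL(2, ℤ)) [Γ.Normal] [Γ.FiniteIndex]
    (htf : ∀ γ ∈ Γ, IsOfFinOrder γ → γ = 1) (q : ℕ) :
    -- elements of `F_q` are determined by their restriction to `S^q D`
    (∀ c : DomainChoice Γ, ∀ f ∈ formsF Γ q, ∀ g ∈ formsF Γ q,
      f =ᵐ[volume.restrict (c.tile q)] g → f = g) ∧
    -- `F_q ∩ L²(S^q D) = L²_q(Γ \ ℍ)`
    (∀ c : DomainChoice Γ, ∀ f ∈ formsF Γ q,
      MemLp f 2 (volume.restrict (c.tile q)) ↔ f ∈ L2q Γ q) ∧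
    -- `π` is the action of `Γ(1)` on `L²_q(Γ \ ℍ)`, and `ι c` is the restriction to `S^q D`
    ∃ (π : Representation ℂ PSL(2, ℤ) (L2q Γ q))
      (ι : ∀ c : DomainChoice Γ, L2q Γ q →ₗ[ℂ] Lp ℂ 2 (volume.restrict (c.tile q))),
      (∀ γ f, (π γ f : ℍ →ₘ[volume] ℂ) = translation γ f) ∧
      (∀ c f, ι c f =ᵐ[volume.restrict (c.tile q)] (f : ℍ →ₘ[volume] ℂ)) ∧
      -- it identifies `L²_q(Γ \ ℍ)` with a closed subspace of `L²(S^q D)`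
      (∀ c, Function.Injective (ι c) ∧ IsClosed (Set.range (ι c))) ∧
      -- the topology is independent of the choices
      (∀ c c', TopologicalSpace.induced (ι c) inferInstance =
        TopologicalSpace.induced (ι c') inferInstance) ∧
      -- the inner product is not, for `q ≥ 1`
      (1 ≤ q → ∀ c, ∃ c', ∃ f g, inner ℂ (ι c f) (ι c g) ≠ inner ℂ (ι c' f) (ι c' g)) ∧
      -- the (discrete) group `Γ(1)` acts continuously
      (∀ c γ, Continuous[TopologicalSpace.induced (ι c) inferInstance,
        TopologicalSpace.induced (ι c) inferInstance] (π γ)) ∧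
      -- the action is unitary exactly if `q = 0` or there is no nonzero homomorphism
      -- `Γ / Γ_par → ℂ`
      (∀ c, (∀ γ f g, inner ℂ (ι c (π γ f)) (ι c (π γ g)) = inner ℂ (ι c f) (ι c g)) ↔
        q = 0 ∨ ∀ χ : Γ →* Multiplicative ℂ, (∀ p ∈ parSubgroup Γ, χ p = 1) → χ = 1) := by
  refine ⟨fun c f hf g hg hfg => c.eq_of_ae_eq_tile hf hg hfg, fun c f hf =>
    (memLp_two_restrict_iff _ f).trans (c.mem_L2q_iff hf), L2qAction Γ q,
    fun c => c.restriction q, fun γ f => rfl, fun c f => c.restriction_ae_eq f,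
    fun c => ⟨c.restriction_injective q, c.isClosed_range_restriction q⟩,
    fun c c' => le_antisymm (c.induced_restriction_le c' q) (c'.induced_restriction_le c q),
    fun hq c => c.exists_inner_ne hq, fun c γ => c.continuous_L2qAction q γ,
    fun c => c.unitary_iff q⟩
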